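/- **Conventions.** Let $N$ be a countably infinite structure in a relational language $L_N$ that is computable (its relation symbols are injectively numbered, the set of numbers is decidable and the arity is computable). Assume that $Th(N)$ is $\omega$-categorical, model complete and decidable. **The structure $M_0$.** Let $L_E=\{E_n : n\ge 1\}$ with $E_n$ of arity $2n$. Consider the finite $L_E$-structures in which each $E_n$ is an equivalence relation on the set of $n$-tuples such that the $n$-tuples with a repeated coordinate (if there are any) form exactly one $E_n$-class. Let $M$ be the countable universal homogeneous structure (Fraïssé limit) of this class, and for $n\ge1$ let $S_n$ be the set of $E_n$-classes of $n$-tuples of $M$ without repeated coordinates, with $\pi_n$ the projection onto $S_n$. Put a model of $Th(N)$ on the set $S_1$, and interpret each $k$-ary symbol $R$ of $L_N$ in $M$ by $R(a_1,\dots,a_k)\Leftrightarrow R(\pi_1(a_1),\dots,\pi_1(a_k))$. The resulting structure in the language $L_0=L_E\cup L_N$ is $M_0$. Fix a presentation of $M_0$ with universe $\omega$ and decidable elementary diagram. **The theory $T$ and the space $\mathbf X_{M_0}$.** Let $L=L_0\cup\{P_{n,i}: n\ge 2,\ i\in\omega\}$ with $P_{n,i}$ of arity $n$, and let $T$ be the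 $L$-theory of all expansions of such countable $L_0$-structures in which each $P_{n,i}$ is interpreted as $\pi_n^{-1}(U_{n,i})$ for some $U_{n,i}\subseteq S_n$. Let $\mathbf X_{M_0}$ be the set of all expansions of $M_0$ to models of $T$, with the natural action of $G=Aut(M_0)$. Let $\mathcal A=\{A_j\}$ be the basis of $\mathbf X_{M_0}$ consisting of the sets of all expansions with a given diagram; a diagram is given by a finite tuple $\bar a$ from $M_0$ and a finite tuple of symbols $P_{n,i}$, and says for each of these symbols which tuples from $\bar a$ satisfy it. Diagrams are coded effectively by natural numbers. **Canonical pieces and degrees.** The pieces of the canonical partition of $\mathbf X_{M_0}$ are the non-empty sets of the form $\bigcap\{GA_j : t(j)=1\}\cap\bigcap\{\mathbf X_{M_0}\setminus GA_j : t(j)=0\}$, where $t$ is a $0$-$1$-function on the set of indices $j$. The degree of $x\in\mathbf X_{M_0}$ is the Turing degree of the set $Sat_x(\mathcal A)$ of (codes of) members of $\mathcal A$ containing $x$. An orbit $Gx$ is of degree $\mathbf d$ if $\mathbf d$ is the least of the degrees of the members of $Gx$; if there is no least one, then $Gx$ has no degree. **Theorem 4.4.** For every such presentation of $M_0$ the canonical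 partition of the $Aut(M_0)$-space $\mathbf X_{M_0}$ has (i) for every Turing degree $\mathbf d$, a piece that is a $G$-orbit of degree $\mathbf d$; (ii) a piece that is a $G$-orbit having no degree. -/

import Mathlib

open FirstOrder FirstOrder.Language

/-! ### Computable relational languages, decidable theories and presentations -/

/-- A computable presentation of a relational language: an injective numbering of its relation
symbols for which it is decidable whether a number is the number of a symbol, and the arity of
the symbol with a given number is computable. -/
structure ComputableLanguage (L : FirstOrder.Language.{0, 0}) where
  symCode : (Σ n, L.Relations n) → ℕ
  injective : Function.Injective symCode
  arity : ℕ → Option ℕ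
  computable_arity : Computable arity
  arity_eq : ∀ m n, arity m = some n ↔ ∃ R : L.Relations n, symCode ⟨n, R⟩ = m

/-- Gödel number of a term (that is, of a variable) of a relational language. -/
def termCode {L : FirstOrder.Language.{0, 0}} [L.IsRelational] {α : Type} [Encodable α] {n : ℕ} :
    L.Term (α ⊕ Fin n) → ℕ
  | .var (.inl a) => 2 * Encodable.encode a
  | .var (.inr i) => 2 * (i : ℕ) + 1
  | .func f _ => isEmptyElim f

/-- Gödel number of a formula of a relational language whose symbols are numbered by `c`. -/
def formulaCode {L : FirstOrder.Language.{0, 0}} [L.IsRelational] (c : (Σ n, L.Relations n) → ℕ)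
    {α : Type} [Encodable α] : ∀ {n : ℕ}, L.BoundedFormula α n → ℕ
  | _, .falsum => Nat.pair 0 0
  | _, .equal s t => Nat.pair 1 (Nat.pair (termCode s) (termCode t))
  | _, .rel (l := l) R ts =>
      Nat.pair 2 (Nat.pair (c ⟨l, R⟩) (Encodable.encode (List.ofFn fun i => termCode (ts i))))
  | _, .imp φ ψ => Nat.pair 3 (Nat.pair (formulaCode c φ) (formulaCode c ψ))
  | _, .all φ => Nat.pair 4 (formulaCode c φ)

/-- The first-order theory of `N` is decidable. -/
def HasDecidableTheory {L : FirstOrder.Language.{0, 0}} [L.IsRelational] (c : (Σ n, L.Relations n) → ℕ)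
    (N : Type) [L.Structure N] : Prop :=
  ComputablePred fun m : ℕ => ∃ φ : L.Sentence, formulaCode c φ = m ∧ N ⊨ φ

/-- The elementary diagram of a structure with universe `ℕ` is decidable. A formula with
parameters is a formula with free variables from `ℕ`, in which the variable `k` stands for
the element `k`. -/
def HasDecidableElementaryDiagram {L : FirstOrder.Language.{0, 0}} [L.IsRelational]
    (c : (Σ n, L.Relations n) → ℕ) [L.Structure ℕ] : Prop :=
  ComputablePred fun m : ℕ => ∃ φ : L.Formula ℕ, formulaCode c φ = m ∧ φ.Realize id

/-- A theory is model complete if every embedding between its models is elementary. -/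
def IsModelComplete {L : FirstOrder.Language.{0, 0}} (T : L.Theory) : Prop :=
  ∀ (A B : Theory.ModelType.{0, 0, 0} T) (f : A ↪[L] B) (n : ℕ) (φ : L.Formula (Fin n))
    (v : Fin n → A), φ.Realize (f ∘ v) ↔ φ.Realize v

/-! ### The universal homogeneous structure with equivalence relations on tuples -/

/-- Relation symbols: for each `n`, one symbol for a relation between `(n + 1)`-tuples. -/
inductive ERel : ℕ → Type
  | E (n : ℕ) : ERel ((n + 1) + (n + 1))

/-- The language `L_E`. -/
def langE : FirstOrder.Language.{0, 0} := ⟨fun _ => Empty, ERel⟩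

instance : langE.IsRelational := fun _ => (inferInstance : IsEmpty Empty)

/-- The relation `E_{n+1}` between `(n + 1)`-tuples. -/
def eRel {M : Type} [langE.Structure M] {n : ℕ} (a b : Fin (n + 1) → M) : Prop :=
  Structure.RelMap (L := langE) (ERel.E n) (Fin.append a b)

/-- Each `E_n` is an equivalence relation on `n`-tuples, one class of which consists exactly of
the tuples with a repeated coordinate (if there are any). -/
def IsEStructure (M : Type) [langE.Structure M] : Prop :=
  ∀ n : ℕ, Equivalence (eRel : (Fin (n + 1) → M) → (Fin (n + 1) → M) → Prop) ∧
    ∀ a b : Fin (n + 1) → M, ¬ Function.Injective a → (eRel a b ↔ ¬ Function.Injective b)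

/-- The class of finite `L_E`-structures of this kind. -/
def classE : Set (CategoryTheory.Bundled.{0} langE.Structure) :=
  {A | Finite A ∧ IsEStructure A}

/-- The sort of classes of `E_{n+1}` on the `(n + 1)`-tuples without repeated coordinates. -/
def ESort (n : ℕ) (M : Type) [langE.Structure M] : Type :=
  Quot fun a b : {a : Fin (n + 1) → M // Function.Injective a} => eRel a.1 b.1

/-- The projection of the tuples without repeated coordinates onto their sort. -/
def eProj {M : Type} [langE.Structure M] {n : ℕ} (a : Fin (n + 1) → M)
    (h : Function.Injective a) : ESort n M :=
  Quot.mk _ ⟨a, h⟩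

/-- The projection of the elements of `M` onto the sort of `E_1`-classes. -/
def eProjOne {M : Type} [langE.Structure M] (m : M) : ESort 0 M :=
  eProj (fun _ => m) fun i j _ => Subsingleton.elim (α := Fin 1) i j

/-! ### The structure `M₀`, the theory `T` and the space of expansions -/

/-- The language `L₀`: `L_E` together with the language of `N`. -/
abbrev langZero (LN : FirstOrder.Language.{0, 0}) : FirstOrder.Language.{0, 0} := langE.sum LN

instance (LN : FirstOrder.Language.{0, 0}) [LN.IsRelational] : (langZero LN).IsRelational :=
  inferInstance

/-- The index `n` of the symbol `E n`. -/
def ERel.index : ∀ {k : ℕ}, ERel k → ℕ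
  | _, .E n => n

/-- The numbering of the symbols of `L₀` obtained from a numbering for the language of `N`. -/
def symCodeZero {LN : FirstOrder.Language.{0, 0}} (c : (Σ n, LN.Relations n) → ℕ) :
    (Σ n, (langZero LN).Relations n) → ℕ
  | ⟨_, .inl e⟩ => 2 * ERel.index e
  | ⟨k, .inr R⟩ => 2 * c ⟨k, R⟩ + 1

/-- `M` is the `L₀`-structure constructed from `N`: its reduct to `L_E` is the countable universal
homogeneous structure, and the symbols of the language of `N` are interpreted in `M` by
pulling back a model of `Th(N)` whose universe is the sort of `E_1`-classes. -/
def IsBaseStructure (LN : FirstOrder.Language.{0, 0}) (N : Type) [LN.Structure N]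
    (M : Type) [Countable M] [langE.Structure M] [LN.Structure M] : Prop :=
  IsFraisseLimit classE M ∧
    ∃ S : LN.Structure (ESort 0 M),
      (letI := S; ESort 0 M ⊨ LN.completeTheory N) ∧
      ∀ (k : ℕ) (R : LN.Relations k) (a : Fin k → M),
        Structure.RelMap R a ↔ S.RelMap R (fun j => eProjOne (a j))

/-- The new relation symbols: `P n i` is the `i`-th symbol of arity `n + 2`. -/
inductive PRel : ℕ → Type
  | P (n i : ℕ) : PRel (n + 2)

/-- The language of the new relation symbols. -/
def langP : FirstOrder.Language.{0, 0} := ⟨fun _ => Empty, PRel⟩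

/-- The interpretation of `P n i` in a structure. -/
def pRel {M : Type} (x : langP.Structure M) (n i : ℕ) (a : Fin (n + 2) → M) : Prop :=
  x.RelMap (PRel.P n i) a

/-- The language `L`. -/
abbrev langFull (LN : FirstOrder.Language.{0, 0}) : FirstOrder.Language.{0, 0} := (langZero LN).sum langP

/-- `M` is one of the structures `M*`: an `L`-structure whose `L₀`-reduct is constructed from `N`
as above, and in which the new symbols of arity `n + 2` are interpreted by pulling back subsets
of the sort of `E_{n+2}`-classes (of tuples without repeated coordinates). -/
def IsStarStructure (LN : FirstOrder.Language.{0, 0}) (N : Type) [LN.Structure N]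
    (M : Type) [Countable M] [langE.Structure M] [LN.Structure M] [x : langP.Structure M] : Prop :=
  IsBaseStructure LN N M ∧
    ∃ U : ∀ n : ℕ, ℕ → Set (ESort (n + 1) M), ∀ (n i : ℕ) (a : Fin (n + 2) → M),
      pRel x n i a ↔ ∃ h : Function.Injective a, eProj a h ∈ U n i

/-- The theory `T` of all the structures `M*`. -/
def starTheory (LN : FirstOrder.Language.{0, 0}) (N : Type) [LN.Structure N] : (langFull LN).Theory :=
  {φ | ∀ (M : Type) [Countable M] [langE.Structure M] [LN.Structure M] [langP.Structure M],
    IsStarStructure LN N M → M ⊨ φ}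

/-- The space of all expansions of the `L₀`-structure with universe `ℕ` to models of `T`. -/
def Expansions (LN : FirstOrder.Language.{0, 0}) (N : Type) [LN.Structure N]
    [langE.Structure ℕ] [LN.Structure ℕ] : Type :=
  {x : langP.Structure ℕ // letI := x; ℕ ⊨ starTheory LN N}

/-- The automorphism group of a structure with universe `ℕ`, as a subgroup of `S_∞`. -/
def autGroup (L : FirstOrder.Language.{0, 0}) [L.Structure ℕ] : Subgroup (Equiv.Perm ℕ) where
  carrier := {g | (∀ (n : ℕ) (f : L.Functions n) (a : Fin n → ℕ),
      g (Structure.funMap f a) = Structure.funMap f (g ∘ a)) ∧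
    ∀ (n : ℕ) (R : L.Relations n) (a : Fin n → ℕ),
      Structure.RelMap R (g ∘ a) ↔ Structure.RelMap R a}
  one_mem' := ⟨fun _ _ _ => rfl, fun _ _ _ => Iff.rfl⟩
  mul_mem' := by
    rintro g h ⟨hg, hg'⟩ ⟨hh, hh'⟩
    refine ⟨fun n f a => ?_, fun n R a => ?_⟩
    · rw [Equiv.Perm.mul_apply, hh, hg]; rfl
    · exact (hg' n R (h ∘ a)).trans (hh' n R a)
  inv_mem' := by
    rintro g ⟨hg, hg'⟩
    have key : ∀ (n : ℕ) (a : Fin n → ℕ), g ∘ ((g⁻¹ : Equiv.Perm ℕ) ∘ a) = a := by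
      intro n a; funext j; simp
    refine ⟨fun n f a => ?_, fun n R a => ?_⟩
    · rw [Equiv.Perm.inv_eq_iff_eq, hg, key]
    · rw [← hg' n R, key]

/-- The image of an expansion under an automorphism of the `L₀`-structure is an expansion to a
model of `T`. -/
theorem model_inducedStructure {LN : FirstOrder.Language.{0, 0}} {N : Type} [LN.Structure N]
    [langE.Structure ℕ] [LN.Structure ℕ] (g : autGroup (langZero LN)) (x : Expansions LN N) :
    letI := @Equiv.inducedStructure langP ℕ ℕ x.1 g.1
    ℕ ⊨ starTheory LN N := by
  let A : (langFull LN).Structure ℕ := @sumStructure _ _ ℕ _ x.1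
  let B : (langFull LN).Structure ℕ :=
    @sumStructure _ _ ℕ _ (@Equiv.inducedStructure langP ℕ ℕ x.1 g.1)
  have key : ∀ (n : ℕ) (a : Fin n → ℕ), g.1.symm ∘ (g.1 ∘ a) = a := by
    intro n a; funext j; simp
  let e : @FirstOrder.Language.Equiv (langFull LN) ℕ ℕ A B :=
    @FirstOrder.Language.Equiv.mk (langFull LN) ℕ ℕ A B g.1
      (by
        rintro n (f | f) a
        · exact g.2.1 n f a
        · exact f.elim)
      (by
        rintro n (R | R) a
        · exact g.2.2 n R a
        · change x.1.RelMap R (g.1.symm ∘ (g.1 ∘ a)) ↔ x.1.RelMap R a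
          rw [key])
  exact (@StrongHomClass.theory_model (langFull LN) ℕ ℕ A B (starTheory LN N) _ _ _ e x.2)

/-- The logic action: `g • x` is the expansion for which `g` is an isomorphism from `x`. -/
instance instMulActionExpansions (LN : FirstOrder.Language.{0, 0}) (N : Type) [LN.Structure N]
    [langE.Structure ℕ] [LN.Structure ℕ] :
    MulAction (autGroup (langZero LN)) (Expansions LN N) where
  smul g x := ⟨@Equiv.inducedStructure langP ℕ ℕ x.1 g.1, model_inducedStructure g x⟩
  one_smul x := by
    apply Subtype.ext
    apply Structure.ext
    · funext n f; exact f.elim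
    · rfl
  mul_smul g h x := by
    apply Subtype.ext
    apply Structure.ext
    · funext n f; exact f.elim
    · rfl

/-! ### The canonical partition -/

/-- The set `G A`. -/
def saturation (G : Type*) {X : Type*} [Group G] [MulAction G X] (A : Set X) : Set X :=
  {x | ∃ g : G, ∃ a ∈ A, g • a = x}

/-- `Y` is a piece of the canonical partition of the `G`-space with the basis `A`: it is non-empty,
and for some 0-1-function `t` on the index set it is the intersection of the sets `G (A j)` with
`t j = 1` and of the complements of the sets `G (A j)` with `t j = 0`. -/
def IsCanonicalPiece (G : Type*) {X ι : Type*} [Group G] [MulAction G X] (A : ι → Set X)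
    (Y : Set X) : Prop :=
  Y.Nonempty ∧ ∃ t : ι → Bool,
    Y = (⋂ j ∈ {j | t j = true}, saturation G (A j)) ∩
      ⋂ j ∈ {j | t j = false}, (saturation G (A j))ᶜ

/-! ### The basis of diagrams, and degrees -/

/-- A diagram is given by a tuple of elements of `M₀ = ℕ`, a tuple of new relation symbols
(`(n, i)` stands for `P n i`), and the list of the atomic facts that are chosen to hold. -/
abbrev DiagramCode : Type := List ℕ × List (ℕ × ℕ) × List ((ℕ × ℕ) × List ℕ)

/-- The basic clopen set of all expansions with the given diagram: each of the listed symbols holds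
of a tuple from the listed elements if and only if this fact was chosen to hold. -/
def basicSet {LN : FirstOrder.Language.{0, 0}} {N : Type} [LN.Structure N]
    [langE.Structure ℕ] [LN.Structure ℕ] (D : DiagramCode) : Set (Expansions LN N) :=
  {x | ∀ p ∈ D.2.1, ∀ b : Fin (p.1 + 2) → ℕ, (∀ j, b j ∈ D.1) →
    (pRel x.1 p.1 p.2 b ↔ (p, List.ofFn b) ∈ D.2.2)}

/-- The set of (codes of) basic sets to which `x` belongs. -/
def satSet {LN : FirstOrder.Language.{0, 0}} {N : Type} [LN.Structure N]
    [langE.Structure ℕ] [LN.Structure ℕ] (x : Expansions LN N) : Set ℕ :=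
  {m | ∃ D : DiagramCode, Encodable.encode D = m ∧ x ∈ basicSet D}

open Classical in
/-- The characteristic function of a set of natural numbers. -/
noncomputable def charFun (A : Set ℕ) : ℕ →. ℕ := fun m => Part.some (if m ∈ A then 1 else 0)

/-- Turing reducibility of sets of natural numbers. -/
def SetTuringReducible (A B : Set ℕ) : Prop := TuringReducible (charFun A) (charFun B)

/-- The Turing degree of the set `D` is the least among the degrees of the members of `Y`, where
the degree of a member `y` is the degree of `satSet y`. -/
def HasDegreeOf {LN : FirstOrder.Language.{0, 0}} {N : Type} [LN.Structure N]
    [langE.Structure ℕ] [LN.Structure ℕ] (Y : Set (Expansions LN N)) (D : Set ℕ) : Prop :=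
  (∃ y ∈ Y, SetTuringReducible (satSet y) D ∧ SetTuringReducible D (satSet y)) ∧
    ∀ y ∈ Y, SetTuringReducible D (satSet y)

/-! The sorts are independent of each other: a one-point extension of a finite subset of `M` exists
with any prescribed classes for the new tuples (`exists_eProj_getD_eq`), so a back-and-forth lifts
every family of permutations of the sorts to an automorphism of the `L_E`-reduct
(`exists_perm_eProj_comp`). A lift that is the identity on `S_1` preserves the symbols of `L_N` as
well. Thus `Aut(M_0)` acts on `S_2, S_3, ...` as arbitrarily as possible.

For (i), let the `i`-th binary symbol hold of all pairs of distinct elements if `i ∈ D`, and of none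
otherwise. This expansion is fixed by `Aut(M_0)`, its orbit is a one-point piece, and the set of its
diagrams is Turing equivalent to `D`.

For (ii), let `c` choose at most one class in each sort `S_2, S_3, ...`, and name the chosen
classes. The orbit is determined by the domain of `c`, and it is a piece, since diagrams detect
whether a symbol is non-empty and whether it meets two classes. A finite part of the diagram never
shows that a sort lies outside the domain: there are infinitely many classes, so one may still be
chosen among those that have not been inspected.

Take `c₁` and `c₂` with the same domain, generic as a pair. If `D` had the least degree in the
orbit, two computations would yield `D` from `c₁` and from `c₂`. By genericity, an initial segment
of the pair forbids disagreement of these computations on all extensions with equal domains. Then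
`D` is computable: search for any finite extension of the initial segment of `c₁` on which the first
computation converges. Its answer must agree with the true computation from `c₂`, because the two
domains can be equalized by adding classes that neither computation sees
(`partrec_charFun_of_not_disagree`). Finite extensions can be evaluated because the relations `E_n`
are decidable in the presentation. So the orbit has a computable member; but genericity also makes
the domain differ from that of each of the countably many computable expansions. -/

/-! ### The use principle for oracle computations -/

/-- `p` is the union of the increasing sequence `F` of partial values. -/
structure IsPartLimit {σ : Type*} (F : ℕ → Part σ) (p : Part σ) : Prop where
  mono : ∀ m m' v, m ≤ m' → v ∈ F m → v ∈ F m'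
  mem_iff : ∀ v, v ∈ p ↔ ∃ m, v ∈ F m

namespace IsPartLimit

variable {σ τ : Type*}

theorem const (p : Part σ) : IsPartLimit (fun _ => p) p :=
  ⟨fun _ _ _ _ h => h, fun _ => ⟨fun h => ⟨0, h⟩, fun ⟨_, h⟩ => h⟩⟩

theorem bind {F : ℕ → Part σ} {p : Part σ} {G : σ → ℕ → Part τ} {q : σ → Part τ}
    (hF : IsPartLimit F p) (hG : ∀ a, IsPartLimit (G a) (q a)) :
    IsPartLimit (fun m => (F m).bind fun a => G a m) (p.bind q) where
  mono m m' v hm h := by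
    obtain ⟨a, ha, hv⟩ := Part.mem_bind_iff.1 h
    exact Part.mem_bind_iff.2 ⟨a, hF.mono m m' a hm ha, (hG a).mono m m' v hm hv⟩
  mem_iff v := by
    constructor
    · intro h
      obtain ⟨a, ha, hv⟩ := Part.mem_bind_iff.1 h
      obtain ⟨m₁, h₁⟩ := (hF.mem_iff a).1 ha
      obtain ⟨m₂, h₂⟩ := ((hG a).mem_iff v).1 hv
      exact ⟨max m₁ m₂, Part.mem_bind_iff.2 ⟨a, hF.mono _ _ _ (le_max_left _ _) h₁,
        (hG a).mono _ _ _ (le_max_right _ _) h₂⟩⟩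
    · rintro ⟨m, h⟩
      obtain ⟨a, ha, hv⟩ := Part.mem_bind_iff.1 h
      exact Part.mem_bind_iff.2 ⟨a, (hF.mem_iff a).2 ⟨m, ha⟩, ((hG a).mem_iff v).2 ⟨m, hv⟩⟩

theorem map {F : ℕ → Part σ} {p : Part σ} (hF : IsPartLimit F p) (f : σ → τ) :
    IsPartLimit (fun m => (F m).map f) (p.map f) := by
  simpa only [Part.bind_some_eq_map] using hF.bind fun a => const (Part.some (f a))

theorem natRec {F : ℕ → Part σ} {p : Part σ} {G : ℕ → σ → ℕ → Part σ} {q : ℕ → σ → Part σ}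
    (hF : IsPartLimit F p) (hG : ∀ y a, IsPartLimit (G y a) (q y a)) (n : ℕ) :
    IsPartLimit
      (fun m => (Nat.rec (F m) (fun y IH => IH.bind fun i => G y i m) n : Part σ))
      (Nat.rec p (fun y IH => IH.bind fun i => q y i) n) := by
  induction n with
  | zero => exact hF
  | succ n ih => exact ih.bind (hG n)

/-- A search that returns `v` consults only the arguments up to `v`; the maximum of finitely many
stages serves them all. -/
theorem rfind {F : ℕ → ℕ → Part Bool} {p : ℕ →. Bool} (h : ∀ n, IsPartLimit (F n) (p n)) :
    IsPartLimit (fun m => Nat.rfind (fun n => F n m : ℕ →. Bool)) (Nat.rfind p) where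
  mono m m' v hm hv := by
    have hv := Nat.mem_rfind.1 hv
    exact Nat.mem_rfind.2
      ⟨(h v).mono _ _ _ hm hv.1, fun {k} hk => (h k).mono _ _ _ hm (hv.2 hk)⟩
  mem_iff v := by
    refine Iff.trans Nat.mem_rfind (Iff.trans ?_ (exists_congr fun m => Nat.mem_rfind.symm))
    constructor
    · rintro ⟨h₁, h₂⟩
      obtain ⟨m₁, hm₁⟩ := ((h v).mem_iff _).1 h₁
      have h₃ : ∀ k, ∃ m, k < v → false ∈ F k m := fun k => by
        by_cases hk : k < v
        · obtain ⟨m, hm⟩ := ((h k).mem_iff _).1 (h₂ hk)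
          exact ⟨m, fun _ => hm⟩
        · exact ⟨0, fun h => absurd h hk⟩
      choose u hu using h₃
      refine ⟨max m₁ ((Finset.range v).sup u), (h v).mono _ _ _ (le_max_left _ _) hm₁,
        fun {k} hk => (h k).mono _ _ _ ?_ (hu k hk)⟩
      exact (Finset.le_sup (f := u) (Finset.mem_range.2 hk)).trans (le_max_right _ _)
    · rintro ⟨m, h₁, h₂⟩
      exact ⟨((h v).mem_iff _).2 ⟨m, h₁⟩, fun hk => ((h _).mem_iff _).2 ⟨m, h₂ hk⟩⟩

end IsPartLimit

/-- The list of the first `m` values of `g`. -/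
def initialSegment {σ : Type*} (g : ℕ → σ) (m : ℕ) : List σ := (List.range m).map g

theorem initialSegment_succ {σ : Type*} (g : ℕ → σ) (m : ℕ) :
    initialSegment g (m + 1) = initialSegment g m ++ [g m] := by
  simp [initialSegment, List.range_succ]

theorem getElem?_initialSegment {σ : Type*} (g : ℕ → σ) (m i : ℕ) :
    (initialSegment g m)[i]? = if i < m then some (g i) else none := by
  split_ifs with h <;> simp [initialSegment, h]

theorem initialSegment_congr {σ : Type*} {g g' : ℕ → σ} {m : ℕ} (h : ∀ i < m, g i = g' i) :
    initialSegment g m = initialSegment g' m :=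
  List.map_congr_left fun i hi => h i (List.mem_range.1 hi)

/-- A function that is recursive in a total function `g` can be computed from finite initial
segments of `g`. -/
theorem exists_initialSegment_of_recursiveIn {g : ℕ → ℕ} {f : ℕ →. ℕ}
    (hf : Nat.RecursiveIn {fun n => Part.some (g n)} f) :
    ∃ F : List ℕ → ℕ →. ℕ, Partrec₂ F ∧
      ∀ k, IsPartLimit (fun m => F (initialSegment g m) k) (f k) := by
  induction hf with
  | zero => exact ⟨fun _ _ => Part.some 0, (Computable.const 0).partrec, fun k => .const _⟩
  | succ => exact ⟨fun _ k => Part.some (Nat.succ k),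
      (Computable.succ.comp Computable.snd).partrec, fun k => .const _⟩
  | left => exact ⟨fun _ k => Part.some (Nat.unpair k).1,
      (Computable.fst.comp (Computable.unpair.comp Computable.snd)).partrec, fun k => .const _⟩
  | right => exact ⟨fun _ k => Part.some (Nat.unpair k).2,
      (Computable.snd.comp (Computable.unpair.comp Computable.snd)).partrec, fun k => .const _⟩
  | oracle o ho =>
    obtain rfl : o = fun n => Part.some (g n) := ho
    -- A query beyond the end of the list diverges instead of receiving a default answer; this makes
    -- the values monotone in the segment.
    refine ⟨fun s k => (s[k]? : Option ℕ), Computable.ofOption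
      (Computable.list_getElem?.comp Computable.fst Computable.snd), fun k => ⟨?_, ?_⟩⟩
    · intro m m' v hm
      simp only [getElem?_initialSegment]
      split_ifs with h₁ h₂
      · exact id
      · omega
      · simp
      · simp
    · intro v
      simp only [getElem?_initialSegment]
      constructor
      · intro h
        refine ⟨k + 1, ?_⟩
        simpa using h
      · rintro ⟨m, hm⟩
        split_ifs at hm
        · simpa using hm
        · simp at hm
  | @pair f h _ _ ihf ihh =>
    obtain ⟨F, hF, hF'⟩ := ihf
    obtain ⟨H, hH, hH'⟩ := ihh
    refine ⟨fun s n => (F s n).bind fun a => (H s n).map fun b => Nat.pair a b, ?_, fun k => ?_⟩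
    · refine Partrec.bind hF (Partrec.map (f := fun q : (List ℕ × ℕ) × ℕ => H q.1.1 q.1.2)
        (hH.comp (Computable.fst.comp Computable.fst) (Computable.snd.comp Computable.fst)) ?_)
      exact Primrec₂.natPair.to_comp.comp (Computable.snd.comp Computable.fst) Computable.snd
    · have := (hF' k).bind fun a => (hH' k).map fun b => Nat.pair a b
      convert this using 1
      ext v
      simp [Seq.seq]
  | @comp f h _ _ ihf ihh =>
    obtain ⟨F, hF, hF'⟩ := ihf
    obtain ⟨H, hH, hH'⟩ := ihh
    refine ⟨fun s n => (H s n).bind (F s), ?_, fun k => (hH' k).bind hF'⟩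
    exact Partrec.bind hH (hF.comp (Computable.fst.comp Computable.fst) Computable.snd)
  | @prec f h _ _ ihf ihh =>
    obtain ⟨F, hF, hF'⟩ := ihf
    obtain ⟨H, hH, hH'⟩ := ihh
    refine ⟨fun s p => (Nat.rec (F s p.unpair.1) (fun y IH => IH.bind fun i =>
      H s (Nat.pair p.unpair.1 (Nat.pair y i))) p.unpair.2 : Part ℕ), ?_, fun k => ?_⟩
    · refine Partrec.nat_rec (f := fun q : List ℕ × ℕ => q.2.unpair.2)
        (g := fun q : List ℕ × ℕ => F q.1 q.2.unpair.1)
        (h := fun (q : List ℕ × ℕ) (r : ℕ × ℕ) => H q.1 (Nat.pair q.2.unpair.1 (Nat.pair r.1 r.2)))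
        ?_ ?_ ?_
      · exact Computable.snd.comp (Computable.unpair.comp Computable.snd)
      · exact hF.comp Computable.fst (Computable.fst.comp (Computable.unpair.comp Computable.snd))
      · refine hH.comp (Computable.fst.comp Computable.fst) ?_
        exact Primrec₂.natPair.to_comp.comp
          (Computable.fst.comp (Computable.unpair.comp (Computable.snd.comp Computable.fst)))
          (Primrec₂.natPair.to_comp.comp (Computable.fst.comp Computable.snd)
            (Computable.snd.comp Computable.snd))
    · exact (hF' k.unpair.1).natRec (fun y i => hH' (Nat.pair k.unpair.1 (Nat.pair y i))) k.unpair.2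
  | @rfind f _ ihf =>
    obtain ⟨F, hF, hF'⟩ := ihf
    refine ⟨fun s a => Nat.rfind fun n => (F s (Nat.pair a n)).map fun m => decide (m = 0), ?_,
      fun k => ?_⟩
    · refine Partrec.rfind (p := fun (q : List ℕ × ℕ) n =>
        (F q.1 (Nat.pair q.2 n)).map fun m => decide (m = 0)) ?_
      refine Partrec.map (f := fun r : (List ℕ × ℕ) × ℕ => F r.1.1 (Nat.pair r.1.2 r.2))
        (hF.comp (Computable.fst.comp Computable.fst) (Primrec₂.natPair.to_comp.comp
          (Computable.snd.comp Computable.fst) Computable.snd)) ?_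
      exact ((Primrec.eq (α := ℕ)).decide.comp Primrec.snd (Primrec.const 0)).to_comp
    · exact IsPartLimit.rfind fun n => (hF' (Nat.pair k n)).map fun m => decide (m = 0)

/-- A computable function of an initial segment of `g`, of computable length, is recursive
in `g`. -/
theorem recursiveIn_of_initialSegment {g : ℕ → ℕ} {h : List ℕ → ℕ → ℕ} (hh : Computable₂ h)
    {b : ℕ → ℕ} (hb : Computable b) :
    Nat.RecursiveIn {fun n => Part.some (g n)}
      fun k => Part.some (h (initialSegment g (b k)) k) := by
  have comp_left : ∀ {p : ℕ → ℕ}, Computable p → Nat.RecursiveIn {fun n => Part.some (g n)}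
      fun k => Part.some (p k) := fun hp => Nat.Partrec.recursiveIn (Partrec.nat_iff.1 hp)
  -- The argument is `pair 0 (pair y s)`, where `0` is a dummy parameter of the recursion and `s`
  -- codes the segment of length `y`; the value `g y` is appended.
  have step : Nat.RecursiveIn {fun n => Part.some (g n)} fun p =>
      Part.some (Encodable.encode (Denumerable.ofNat (List ℕ) p.unpair.2.unpair.2 ++
        [g p.unpair.2.unpair.1])) := by
    have h₁ : Computable fun q : ℕ => Encodable.encode
        (Denumerable.ofNat (List ℕ) q.unpair.1 ++ [q.unpair.2]) :=
      Computable.encode.comp (Computable.list_concat.comp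
        ((Computable.ofNat (List ℕ)).comp (Computable.fst.comp Computable.unpair))
        (Computable.snd.comp Computable.unpair))
    have h₂ : Computable fun p : ℕ => p.unpair.2.unpair.2 :=
      Computable.snd.comp (Computable.unpair.comp (Computable.snd.comp Computable.unpair))
    have h₃ : Computable fun p : ℕ => p.unpair.2.unpair.1 :=
      Computable.fst.comp (Computable.unpair.comp (Computable.snd.comp Computable.unpair))
    refine (Nat.RecursiveIn.comp (comp_left h₁) (Nat.RecursiveIn.pair (comp_left h₂)
      (Nat.RecursiveIn.comp (.oracle _ (Set.mem_singleton _)) (comp_left h₃)))).of_eq fun p => ?_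
    simp [Seq.seq]
  have seg : Nat.RecursiveIn {fun n => Part.some (g n)} fun m =>
      Part.some (Encodable.encode (initialSegment g m)) := by
    refine (Nat.RecursiveIn.comp (Nat.RecursiveIn.prec
      (comp_left (Computable.const (Encodable.encode ([] : List ℕ)))) step)
      (comp_left (Primrec₂.natPair.comp (Primrec.const 0) Primrec.id).to_comp)).of_eq fun m => ?_
    simp only [Part.bind_eq_bind, Part.bind_some, Nat.unpair_pair, id]
    induction m with
    | zero => rfl
    | succ m ih => simp only [ih, initialSegment_succ, Part.bind_some, Denumerable.ofNat_encode]
  have last : Computable fun q : ℕ => h (Denumerable.ofNat (List ℕ) q.unpair.1) q.unpair.2 :=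
    hh.comp ((Computable.ofNat (List ℕ)).comp (Computable.fst.comp Computable.unpair))
      (Computable.snd.comp Computable.unpair)
  refine (Nat.RecursiveIn.comp (comp_left last) (Nat.RecursiveIn.pair
    (Nat.RecursiveIn.comp seg (comp_left hb)) (comp_left Computable.id))).of_eq fun k => ?_
  simp [Seq.seq]

/-! ### Computability of operations on lists -/

theorem Computable.list_all {α β : Type*} [Primcodable α] [Primcodable β] {l : α → List β}
    {f : α → β → Bool} (hl : Computable l) (hf : Computable₂ f) :
    Computable fun a => (l a).all (f a) := by
  -- An index out of range contributes `true`, so the recursion up to `n` tests exactly the first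
  -- `n` elements.
  have key : ∀ (a : α) (n : ℕ), (Nat.rec true (fun i acc => acc &&
      (((l a)[i]?).map (f a)).getD true) n : Bool) = ((l a).take n).all (f a) := by
    intro a n
    induction n with
    | zero => simp
    | succ n ih =>
      rw [List.take_add_one, List.all_append]
      simp only [ih]
      cases (l a)[n]? <;> simp
  have : Computable fun a => (Nat.rec true (fun i acc => acc &&
      (((l a)[i]?).map (f a)).getD true) (l a).length : Bool) := by
    refine Computable.nat_rec (f := fun a => (l a).length) (g := fun _ => true)
      (h := fun a (p : ℕ × Bool) => p.2 && (((l a)[p.1]?).map (f a)).getD true)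
      (Computable.list_length.comp hl) (Computable.const true) ?_
    refine Primrec.and.to_comp.comp (Computable.snd.comp Computable.snd) ?_
    refine Computable.option_getD (Computable.option_map
      (f := fun q : α × ℕ × Bool => (l q.1)[q.2.1]?) (g := fun q b => f q.1 b)
      (Computable.list_getElem?.comp (hl.comp Computable.fst)
        (Computable.fst.comp Computable.snd)) ?_) (Computable.const true)
    exact hf.comp (Computable.fst.comp Computable.fst) Computable.snd
  exact this.of_eq fun a => by rw [key, List.take_length]

theorem Computable.initialSegment {α β : Type*} [Primcodable α] [Primcodable β] {n : α → ℕ}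
    {f : α → ℕ → β} (hn : Computable n) (hf : Computable₂ f) :
    Computable fun a => initialSegment (f a) (n a) := by
  have : Computable fun a => (Nat.rec [] (fun i s => s ++ [f a i]) (n a) : List β) :=
    Computable.nat_rec (f := n) (g := fun _ => []) (h := fun a (p : ℕ × List β) => p.2 ++ [f a p.1])
      hn (Computable.const []) (Computable.list_concat.comp (Computable.snd.comp Computable.snd)
        (hf.comp Computable.fst (Computable.fst.comp Computable.snd)))
  refine this.of_eq fun a => ?_
  induction n a with
  | zero => rfl
  | succ m ih => rw [initialSegment_succ, ← ih]

/-- The list of all `k`-tuples from a list. -/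
def tuplesFrom (L : List ℕ) (k : ℕ) : List (List ℕ) :=
  Nat.rec [([] : List ℕ)] (fun _ T => T.flatMap fun t => L.map fun a => a :: t) k

theorem mem_tuplesFrom {L : List ℕ} {k : ℕ} {t : List ℕ} :
    t ∈ tuplesFrom L k ↔ t.length = k ∧ ∀ a ∈ t, a ∈ L := by
  induction k generalizing t with
  | zero =>
    have : tuplesFrom L 0 = [([] : List ℕ)] := rfl
    rw [this, List.mem_singleton, List.length_eq_zero_iff]
    exact ⟨fun h => ⟨h, by simp [h]⟩, fun h => h.1⟩
  | succ k ih =>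
    have : tuplesFrom L (k + 1) = (tuplesFrom L k).flatMap fun t => L.map fun a => a :: t := rfl
    rw [this, List.mem_flatMap]
    constructor
    · rintro ⟨s, hs, h⟩
      obtain ⟨a, ha, rfl⟩ := List.mem_map.1 h
      obtain ⟨h₁, h₂⟩ := ih.1 hs
      simp [h₁, ha]
      exact h₂
    · rintro ⟨h₁, h₂⟩
      cases t with
      | nil => simp at h₁
      | cons a t =>
        refine ⟨t, ih.2 ⟨by simpa using h₁, fun b hb => h₂ b (List.mem_cons_of_mem _ hb)⟩, ?_⟩
        exact List.mem_map.2 ⟨a, h₂ a List.mem_cons_self, rfl⟩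

theorem primrec₂_tuplesFrom : Primrec₂ tuplesFrom := by
  refine Primrec.nat_rec' (f := fun q : List ℕ × ℕ => q.2) (g := fun _ => [([] : List ℕ)])
    (h := fun (q : List ℕ × ℕ) (p : ℕ × List (List ℕ)) =>
      p.2.flatMap fun t => q.1.map fun a => a :: t) Primrec.snd (Primrec.const _) ?_
  refine Primrec.list_flatMap (Primrec.snd.comp Primrec.snd) ?_
  refine Primrec.list_map (Primrec.fst.comp (Primrec.fst.comp Primrec.fst)) ?_
  exact Primrec.list_cons.comp Primrec.snd (Primrec.snd.comp Primrec.fst)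

theorem primrec_list_mem {α : Type*} [Primcodable α] [DecidableEq α] :
    Primrec₂ fun (a : α) (l : List α) => decide (a ∈ l) := by
  have h : PrimrecRel fun (l : List α) (b : α) => ∃ a ∈ l, a = b :=
    PrimrecRel.exists_mem_list Primrec.eq
  have h' : PrimrecRel fun (l : List α) (b : α) => b ∈ l := h.of_eq fun l b => by simp
  exact (PrimrecRel.decide h').comp Primrec.snd Primrec.fst

theorem primrec_list_nodup : Primrec fun l : List ℕ => decide l.Nodup := by
  have h : Primrec fun l : List ℕ => (List.rec true (fun a l b => !decide (a ∈ l) && b) l : Bool) :=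
    Primrec.list_rec (f := fun l : List ℕ => l) (g := fun _ => true)
      (h := fun _ (p : ℕ × List ℕ × Bool) => !decide (p.1 ∈ p.2.1) && p.2.2)
      Primrec.id (Primrec.const true)
      (Primrec.and.comp (Primrec.not.comp (primrec_list_mem.comp (Primrec.fst.comp Primrec.snd)
        (Primrec.fst.comp (Primrec.snd.comp Primrec.snd))))
        (Primrec.snd.comp (Primrec.snd.comp Primrec.snd)))
  refine h.of_eq fun l => ?_
  induction l with
  | nil => simp
  | cons a l ih => simp [ih]

/-! ### Evaluation of diagrams -/

/-- All atomic facts about the elements and symbols of a diagram. -/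
def diagramFacts (D : DiagramCode) : List ((ℕ × ℕ) × List ℕ) :=
  D.2.1.flatMap fun p => (tuplesFrom D.1 (p.1 + 2)).map fun b => (p, b)

/-- The diagram `D` is true if the truth values of the atomic facts are given by `q`. -/
def diagramHolds (q : (ℕ × ℕ) × List ℕ → Bool) (D : DiagramCode) : Bool :=
  (diagramFacts D).all fun r => q r == decide (r ∈ D.2.2)

theorem primrec_diagramFacts : Primrec diagramFacts := by
  refine Primrec.list_flatMap (Primrec.fst.comp Primrec.snd) ?_
  refine Primrec.list_map (primrec₂_tuplesFrom.comp (Primrec.fst.comp Primrec.fst)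
    (Primrec.nat_add.comp (Primrec.fst.comp Primrec.snd) (Primrec.const 2))) ?_
  exact Primrec.pair (Primrec.snd.comp Primrec.fst) Primrec.snd

theorem mem_diagramFacts {D : DiagramCode} {r : (ℕ × ℕ) × List ℕ} :
    r ∈ diagramFacts D ↔ r.1 ∈ D.2.1 ∧ r.2.length = r.1.1 + 2 ∧ ∀ a ∈ r.2, a ∈ D.1 := by
  obtain ⟨p, b⟩ := r
  simp only [diagramFacts, List.mem_flatMap, List.mem_map, mem_tuplesFrom, Prod.mk.injEq]
  constructor
  · rintro ⟨p', hp', b', hb', rfl, rfl⟩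
    exact ⟨hp', hb'⟩
  · rintro ⟨h₁, h₂⟩
    exact ⟨p, h₁, b, h₂, rfl, rfl⟩

theorem computable_diagramHolds {α : Type*} [Primcodable α] {q : α → (ℕ × ℕ) × List ℕ → Bool}
    (hq : Computable₂ q) : Computable₂ fun a D => diagramHolds (q a) D := by
  have h₁ : Computable fun t : (α × DiagramCode) × ((ℕ × ℕ) × List ℕ) => q t.1.1 t.2 :=
    hq.comp (Computable.fst.comp Computable.fst) Computable.snd
  have h₂ : Computable fun t : (α × DiagramCode) × ((ℕ × ℕ) × List ℕ) => t.1.2.2.2 :=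
    Computable.snd.comp (Computable.snd.comp (Computable.snd.comp Computable.fst))
  have h₃ : Computable fun t : (α × DiagramCode) × ((ℕ × ℕ) × List ℕ) =>
      decide (t.2 ∈ t.1.2.2.2) :=
    ((primrec_list_mem (α := (ℕ × ℕ) × List ℕ)).to_comp.comp Computable.snd h₂ :).of_eq
      fun t => decide_eq_decide.2 Iff.rfl
  have h₄ : Computable fun t : (α × DiagramCode) × ((ℕ × ℕ) × List ℕ) =>
      (q t.1.1 t.2 == decide (t.2 ∈ t.1.2.2.2)) :=
    ((Primrec.beq (α := Bool)).to_comp.comp h₁ h₃ :).of_eq fun t => rfl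
  have h₅ : Computable fun r : α × DiagramCode => diagramFacts r.2 :=
    primrec_diagramFacts.to_comp.comp Computable.snd
  exact Computable.list_all h₅ (Computable₂.mk (f := fun (r : α × DiagramCode)
    (s : (ℕ × ℕ) × List ℕ) => q r.1 s == decide (s ∈ r.2.2.2)) h₄)

/-! ### Structures with equivalence relations on tuples -/

theorem eProj_congr {M : Type} [langE.Structure M] {n : ℕ} {a b : Fin (n + 1) → M} (hab : a = b)
    (h : Function.Injective a) (h' : Function.Injective b) : eProj a h = eProj b h' := by
  subst hab
  rfl

theorem comp_append_fin {A B : Type*} (f : A → B) {m n : ℕ} (a : Fin m → A) (b : Fin n → A) :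
    f ∘ Fin.append a b = Fin.append (f ∘ a) (f ∘ b) := by
  funext i
  refine Fin.addCases (fun i => ?_) (fun i => ?_) i <;> simp

theorem append_castAdd_natAdd {A : Type*} {m n : ℕ} (x : Fin (m + n) → A) :
    Fin.append (x ∘ Fin.castAdd n) (x ∘ Fin.natAdd m) = x := by
  funext i
  refine Fin.addCases (fun i => ?_) (fun i => ?_) i <;> simp

/-- The `L_E`-structure in which two tuples are equivalent if and only if `cls` takes the same
value on them. -/
abbrev eStructure {B : Type} {γ : ℕ → Type} (cls : ∀ n, (Fin (n + 1) → B) → γ n) :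
    langE.Structure B where
  funMap f := isEmptyElim (α := Empty) f
  RelMap {k} (R : ERel k) := match k, R with
    | _, ERel.E n => fun v => cls n (v ∘ Fin.castAdd (n + 1)) = cls n (v ∘ Fin.natAdd (n + 1))

theorem eRel_eStructure {B : Type} {γ : ℕ → Type} (cls : ∀ n, (Fin (n + 1) → B) → γ n) {n : ℕ}
    (a b : Fin (n + 1) → B) :
    letI := eStructure cls
    eRel a b ↔ cls n a = cls n b := by
  have h₁ : Fin.append a b ∘ Fin.castAdd (n + 1) = a := funext (Fin.append_left a b)
  have h₂ : Fin.append a b ∘ Fin.natAdd (n + 1) = b := funext (Fin.append_right a b)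
  change cls n (Fin.append a b ∘ Fin.castAdd (n + 1)) = cls n (Fin.append a b ∘ Fin.natAdd (n + 1))
    ↔ _
  rw [h₁, h₂]

theorem isEStructure_eStructure {B : Type} {γ : ℕ → Type} (cls : ∀ n, (Fin (n + 1) → B) → γ n)
    (h : ∀ n a b, ¬ Function.Injective a → (cls n a = cls n b ↔ ¬ Function.Injective b)) :
    letI := eStructure cls
    IsEStructure B := by
  let _ := eStructure cls
  refine fun n => ⟨⟨fun a => ?_, fun {a b} => ?_, fun {a b c} => ?_⟩, fun a b => ?_⟩
  all_goals simp only [eRel_eStructure]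
  · exact Eq.symm
  · exact Eq.trans
  · exact h n a b

theorem eRel_comp {A B : Type} [langE.Structure A] [langE.Structure B] (φ : A ↪[langE] B) {n : ℕ}
    (a b : Fin (n + 1) → A) : eRel (φ ∘ a) (φ ∘ b) ↔ eRel a b := by
  unfold eRel
  rw [← comp_append_fin]
  exact φ.map_rel (ERel.E n) _

/-- An injective map that preserves and reflects all `E_n` is an embedding. -/
def eEmbedding {A B : Type} [langE.Structure A] [langE.Structure B] (f : A → B)
    (hf : Function.Injective f)
    (h : ∀ n (a b : Fin (n + 1) → A), eRel (f ∘ a) (f ∘ b) ↔ eRel a b) : A ↪[langE] B where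
  toFun := f
  inj' := hf
  map_fun' g := isEmptyElim (α := Empty) g
  map_rel' := by
    rintro _ ⟨n⟩ x
    have := h n (x ∘ Fin.castAdd (n + 1)) (x ∘ Fin.natAdd (n + 1))
    unfold eRel at this
    rw [← comp_append_fin, append_castAdd_natAdd] at this
    exact this

section FraisseLimit

variable {M : Type} [langE.Structure M]

/-- A quotient by a relation identifies along the generated equivalence; here the relation already
is an equivalence. -/
theorem IsEStructure.eProj_eq_iff (hE : IsEStructure M) {n : ℕ}
    {a b : Fin (n + 1) → M} {h : Function.Injective a} {h' : Function.Injective b} :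
    eProj a h = eProj b h' ↔ eRel a b := by
  have := (hE n).1
  exact Quot.eq.trans (Equivalence.eqvGen_iff (r := fun a b : {a : Fin (n + 1) → M //
    Function.Injective a} => eRel a.1 b.1)
    ⟨fun a => this.refl _, fun h => this.symm h, fun h h' => this.trans h h'⟩)

theorem mem_age_of_isFraisseLimit [Countable M] (hM : IsFraisseLimit classE M) {B : Type} [s : langE.Structure B]
    [Finite B] (hB : IsEStructure B) : Nonempty (B ↪[langE] M) := by
  have : (⟨B, s⟩ : CategoryTheory.Bundled langE.Structure) ∈ langE.age M := by
    rw [hM.age]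
    exact ⟨‹_›, hB⟩
  exact this.2

/-- Each axiom speaks of at most three tuples, so it can be checked in the substructure generated by
their entries; finitely generated substructures belong to the age, which is `classE`. -/
theorem isEStructure_of_isFraisseLimit [Countable M] (hM : IsFraisseLimit classE M) : IsEStructure M := by
  have key : ∀ s : Set M, s.Finite → IsEStructure (Substructure.closure langE s) := by
    intro s hs
    have := age.fg_substructure (Substructure.fg_closure (L := langE) hs)
    rw [hM.age] at this
    exact this.2
  have lift : ∀ (s : Set M) (n : ℕ) (a : Fin (n + 1) → M), Set.range a ⊆ s →
      ∃ a' : Fin (n + 1) → Substructure.closure langE s,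
        a = (Substructure.subtype _) ∘ a' := fun s n a h =>
    ⟨fun i => ⟨a i, Substructure.subset_closure (h ⟨i, rfl⟩)⟩, rfl⟩
  have cover : ∀ (n : ℕ) (a b c : Fin (n + 1) → M), ∃ s : Set M, s.Finite ∧ Set.range a ⊆ s ∧
      Set.range b ⊆ s ∧ Set.range c ⊆ s := fun n a b c =>
    ⟨Set.range a ∪ Set.range b ∪ Set.range c,
      ((Set.finite_range a).union (Set.finite_range b)).union (Set.finite_range c),
      Set.subset_union_left.trans Set.subset_union_left,
      Set.subset_union_right.trans Set.subset_union_left, Set.subset_union_right⟩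
  refine fun n => ⟨⟨fun a => ?_, fun {a b} => ?_, fun {a b c} => ?_⟩, fun a b => ?_⟩
  · obtain ⟨s, hs, h₁, -, -⟩ := cover n a a a
    obtain ⟨a, rfl⟩ := lift _ _ a h₁
    rw [eRel_comp]
    exact (key s hs n).1.refl a
  · obtain ⟨s, hs, h₁, h₂, -⟩ := cover n a b b
    obtain ⟨a, rfl⟩ := lift _ _ a h₁
    obtain ⟨b, rfl⟩ := lift _ _ b h₂
    rw [eRel_comp, eRel_comp]
    exact (key s hs n).1.symm
  · obtain ⟨s, hs, h₁, h₂, h₃⟩ := cover n a b c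
    obtain ⟨a, rfl⟩ := lift _ _ a h₁
    obtain ⟨b, rfl⟩ := lift _ _ b h₂
    obtain ⟨c, rfl⟩ := lift _ _ c h₃
    rw [eRel_comp, eRel_comp, eRel_comp]
    exact (key s hs n).1.trans
  · obtain ⟨s, hs, h₁, h₂, -⟩ := cover n a b b
    obtain ⟨a, rfl⟩ := lift _ _ a h₁
    obtain ⟨b, rfl⟩ := lift _ _ b h₂
    have inj := (Substructure.subtype (Substructure.closure langE s)).injective
    rw [eRel_comp, inj.of_comp_iff, inj.of_comp_iff]
    exact (key s hs n).2 a b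

/-- Any number `K` of classes occurs: on `n + K` points let distinct tuples without repetitions be
inequivalent, embed this structure, and take `K` tuples that share their first `n` entries and
differ in the last. -/
theorem infinite_eSort [Countable M] (hM : IsFraisseLimit classE M) (n : ℕ) : Infinite (ESort n M) := by
  classical
  have hE := isEStructure_of_isFraisseLimit hM
  have key : ∀ K : ℕ, ∃ f : Fin K → ESort n M, Function.Injective f := by
    intro K
    let cls : ∀ k, (Fin (k + 1) → Fin (n + K)) → Option (Fin (k + 1) → Fin (n + K)) :=
      fun k a => if Function.Injective a then some a else none
    let _ := eStructure cls
    have hB : IsEStructure (Fin (n + K)) := isEStructure_eStructure cls fun k a b ha => by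
      by_cases hb : Function.Injective b <;> simp [cls, ha, hb]
    obtain ⟨φ⟩ := mem_age_of_isFraisseLimit hM hB
    let a : Fin K → Fin (n + 1) → Fin (n + K) :=
      fun j => Fin.snoc (fun i => Fin.castAdd K i) (Fin.natAdd n j)
    have ha : ∀ j, Function.Injective (a j) := fun j => by
      refine Fin.snoc_injective_iff.2 ⟨Fin.castAdd_injective _ _, ?_⟩
      rintro ⟨i, hi⟩
      have := congrArg Fin.val hi
      simp at this
      omega
    refine ⟨fun j => eProj (φ ∘ a j) (φ.injective.comp (ha j)), fun j j' h => ?_⟩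
    have h₁ := (eRel_comp φ _ _).1 (hE.eProj_eq_iff.1 h)
    rw [eRel_eStructure] at h₁
    simp only [cls, ha, if_true, Option.some.injEq] at h₁
    have := congrFun h₁ (Fin.last n)
    simpa [a] using this
  by_contra h
  rw [not_infinite_iff_finite] at h
  obtain ⟨f, hf⟩ := key (Nat.card (ESort n M) + 1)
  have := Nat.card_le_card_of_injective f hf
  simp at this

/-- One-point extensions of finite sets exist with arbitrarily prescribed classes. -/
theorem exists_eProj_getD_eq [Countable M] (hM : IsFraisseLimit classE M) (s : Finset M)
    (κ : ∀ n, (Fin (n + 1) → Option M) → ESort n M)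
    (hκ : ∀ n (a : Fin (n + 1) → M) (h : Function.Injective a), κ n (some ∘ a) = eProj a h) :
    ∃ m, m ∉ s ∧ ∀ n (t : Fin (n + 1) → Option M), Function.Injective t →
      (∀ i, ∀ x ∈ t i, x ∈ s) →
      ∃ h : Function.Injective fun i => (t i).getD m, eProj (fun i => (t i).getD m) h = κ n t := by
  classical
  have hE := isEStructure_of_isFraisseLimit hM
  have hrep : ∀ n (c : ESort n M), ∃ a : Fin (n + 1) → M, ∃ h : Function.Injective a,
      eProj a h = c := fun n c => by
    obtain ⟨⟨a, h⟩, rfl⟩ := Quot.exists_rep c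
    exact ⟨a, h, rfl⟩
  choose rep repInj hrep using hrep
  -- Besides `s`, the finite set `Q` contains representatives of all classes to be prescribed, so
  -- that the prescription can be expressed inside a finite structure. A tuple without repetitions
  -- from `Option s` has length at most `s.card + 1`, which bounds `n`.
  let Q : Set M := ↑s ∪ ⋃ p : Σ n : Fin (s.card + 1), (Fin (n + 1) → Option s),
    Set.range (rep p.1 (κ p.1 fun i => (p.2 i).map Subtype.val))
  have hQ : Q.Finite := s.finite_toSet.union (Set.finite_iUnion fun p => Set.finite_range _)
  have : Finite Q := hQ
  -- The element `none` of `Option Q` is the new point. The value `none` of `cls` marks the class of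
  -- the tuples with a repetition.
  let cls : ∀ n, (Fin (n + 1) → Option Q) → Option (ESort n M) := fun n u =>
    if Function.Injective u then some (κ n fun i => (u i).map Subtype.val) else none
  let _ := eStructure cls
  let _ : langE.Structure Q := eStructure fun n (a : Fin (n + 1) → Q) => cls n (some ∘ a)
  have hB : IsEStructure (Option Q) := isEStructure_eStructure cls fun k a b ha => by
    by_cases hb : Function.Injective b <;> simp [cls, ha, hb]
  let g : Q ↪[langE] Option Q := eEmbedding some (Option.some_injective _) fun n a b => by
    rw [eRel_eStructure, eRel_eStructure]
  have hcls : ∀ n (a : Fin (n + 1) → Q) (h : Function.Injective a),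
      cls n (some ∘ a) = some (eProj (Subtype.val ∘ a) (Subtype.val_injective.comp h)) := by
    intro n a h
    have h' : Function.Injective (some ∘ a) := (Option.some_injective _).comp h
    simp only [cls, if_pos h']
    rw [← hκ]
    rfl
  have hcls' : ∀ n (a : Fin (n + 1) → Q), ¬ Function.Injective a → cls n (some ∘ a) = none := by
    intro n a h
    have h' : ¬ Function.Injective (some ∘ a) := fun h' => h h'.of_comp
    simp only [cls, if_neg h']
  let f : Q ↪[langE] M := eEmbedding Subtype.val Subtype.val_injective fun n a b => by
    rw [eRel_eStructure]
    by_cases ha : Function.Injective a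
    · by_cases hb : Function.Injective b
      · rw [hcls n a ha, hcls n b hb, Option.some.injEq, hE.eProj_eq_iff]
      · rw [hcls n a ha, hcls' n b hb]
        simp only [reduceCtorEq, iff_false]
        intro h
        have := ((hE n).2 (Subtype.val ∘ b) (Subtype.val ∘ a) (fun h' => hb h'.of_comp)).1
          ((hE n).1.symm h)
        exact this (Subtype.val_injective.comp ha)
    · rw [hcls' n a ha, (hE n).2 (Subtype.val ∘ a) (Subtype.val ∘ b) (fun h' => ha h'.of_comp)]
      by_cases hb : Function.Injective b
      · simp [hcls n b hb, Subtype.val_injective.comp hb]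
      · rw [hcls' n b hb]
        exact iff_of_true (fun h' : Function.Injective (Subtype.val ∘ b) => hb h'.of_comp) rfl
  have := mem_age_of_isFraisseLimit hM hB
  -- By ultrahomogeneity the copy of `Option Q` can be placed so that it extends the inclusion of
  -- `Q`; the image of `none` is the required point.
  obtain ⟨F, hF⟩ := hM.ultrahomogeneous.extend_embedding
    ((Structure.fg_iff_finite).2 (inferInstance : Finite Q)) f g
  have hF' : ∀ q : Q, F (some q) = q := fun q => (DFunLike.congr_fun hF q).symm
  have sQ : ∀ {x}, x ∈ s → x ∈ Q := fun h => Or.inl h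
  refine ⟨F none, fun h => ?_, fun n t ht hts => ?_⟩
  · have := hF' ⟨F none, sQ h⟩
    exact Option.some_ne_none _ (F.injective this)
  · let u : Fin (n + 1) → Option Q := fun i => (t i).pmap Subtype.mk fun x hx => sQ (hts i x hx)
    let v : Fin (n + 1) → Option s := fun i => (t i).pmap Subtype.mk fun x hx => hts i x hx
    have hut : ∀ i, (u i).map Subtype.val = t i := fun i => by simp [u, Option.map_pmap]
    have hvt : ∀ i, (v i).map Subtype.val = t i := fun i => by simp [v, Option.map_pmap]
    have hu : Function.Injective u := fun i j h => ht (by rw [← hut, ← hut, h])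
    have hv : Function.Injective v := fun i j h => ht (by rw [← hvt, ← hvt, h])
    have hFu : (fun i => (t i).getD (F none)) = F ∘ u := by
      funext i
      rw [← hut i]
      cases h : u i with
      | none => simp [h]
      | some q => simp [h, hF']
    have hn : n < s.card + 1 := by
      have := Fintype.card_le_of_injective v hv
      simpa using this
    have hr : ∀ i, rep n (κ n t) i ∈ Q := fun i => by
      refine Or.inr (Set.mem_iUnion.2 ⟨⟨⟨n, hn⟩, v⟩, i, ?_⟩)
      simp only [hvt]
    let r : Fin (n + 1) → Q := fun i => ⟨rep n (κ n t) i, hr i⟩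
    have hrInj : Function.Injective r := fun i j h => repInj n (κ n t) (congrArg Subtype.val h)
    have hinj : Function.Injective fun i => (t i).getD (F none) := by
      rw [hFu]
      exact F.injective.comp hu
    refine ⟨hinj, ?_⟩
    rw [← hrep n (κ n t), hE.eProj_eq_iff, hFu]
    have : rep n (κ n t) = F ∘ (some ∘ r) := by
      funext i
      simp [hF', r]
    rw [this, eRel_comp, eRel_eStructure, hcls n r hrInj]
    simp only [cls, if_pos hu, hut, Option.some.injEq]
    exact (hrep n (κ n t)).symm

/-- A finite partial injective map that acts on classes of tuples as `f`. -/
def IsPartialLift (f : ∀ n, Equiv.Perm (ESort n M)) (p : Finset (M × M)) : Prop :=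
  (∀ a ∈ p, ∀ b ∈ p, a.1 = b.1 ↔ a.2 = b.2) ∧
    ∀ n (t : Fin (n + 1) → M × M), (∀ i, t i ∈ p) → ∀ (h : Function.Injective (Prod.fst ∘ t))
      (h' : Function.Injective (Prod.snd ∘ t)), f n (eProj _ h) = eProj _ h'

/-- This turns the extension of the domain into the extension of the range, so only one half of the
back-and-forth has to be proved. -/
theorem IsPartialLift.symm [DecidableEq M] {f : ∀ n, Equiv.Perm (ESort n M)} {p : Finset (M × M)}
    (hp : IsPartialLift f p) : IsPartialLift (fun n => (f n).symm) (p.image Prod.swap) := by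
  have mem : ∀ {a : M × M}, a ∈ p.image Prod.swap → a.swap ∈ p := fun h => by
    obtain ⟨b, hb, rfl⟩ := Finset.mem_image.1 h
    simpa using hb
  refine ⟨fun a ha b hb => ?_, fun n t ht h h' => ?_⟩
  · exact (hp.1 _ (mem ha) _ (mem hb)).symm
  · rw [Equiv.symm_apply_eq]
    exact (hp.2 n (Prod.swap ∘ t) (fun i => mem (ht i)) h' h).symm

/-- The image of `m` must realize, together with the old range, the `f`-images of the classes that
`m` forms with the old domain. Free one-point extensions provide such an element outside the old
range. -/
theorem IsPartialLift.exists_extension [DecidableEq M] [Countable M] [Infinite M]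
    (hM : IsFraisseLimit classE M)
    {f : ∀ n, Equiv.Perm (ESort n M)} {p : Finset (M × M)}
    (hp : IsPartialLift f p) (m : M) : ∃ p', p ⊆ p' ∧ IsPartialLift f p' ∧ ∃ m', (m, m') ∈ p' := by
  classical
  by_cases hm : ∃ m', (m, m') ∈ p
  · exact ⟨p, subset_rfl, hp, hm⟩
  let s := p.image Prod.snd
  -- On the range of `p` this is the inverse of `p`, and the new point is sent to `m`; the value
  -- elsewhere is immaterial.
  let u : Option M → M := fun o => o.elim m fun q => if h : ∃ x, (x, q) ∈ p then h.choose else q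
  have hu : ∀ a ∈ p, u (some a.2) = a.1 := fun a ha => by
    have h : ∃ x, (x, a.2) ∈ p := ⟨a.1, ha⟩
    simp only [u, Option.elim, dif_pos h]
    exact (hp.1 _ h.choose_spec a ha).2 rfl
  -- Tuples without the new point keep their own class. The others get the `f`-image of the class of
  -- their preimage, or an irrelevant default if the preimage has a repetition.
  let κ : ∀ n, (Fin (n + 1) → Option M) → ESort n M := fun n t =>
    if h : ∃ a : Fin (n + 1) → M, Function.Injective a ∧ t = some ∘ a then
      eProj h.choose h.choose_spec.1
    else if h : Function.Injective (u ∘ t) then f n (eProj (u ∘ t) h)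
    else eProj (Infinite.natEmbedding M ∘ Fin.val)
      ((Infinite.natEmbedding M).injective.comp Fin.val_injective)
  obtain ⟨m', hm', H⟩ := exists_eProj_getD_eq hM s κ fun n a h => by
    have h' : ∃ b : Fin (n + 1) → M, Function.Injective b ∧ some ∘ a = some ∘ b := ⟨a, h, rfl⟩
    simp only [κ, dif_pos h']
    refine eProj_congr ?_ _ _
    funext i
    exact (Option.some_injective _ (congrFun h'.choose_spec.2 i)).symm
  have hpm : ∀ a ∈ p, a.1 ≠ m ∧ a.2 ≠ m' := fun a ha =>
    ⟨fun h => hm ⟨a.2, h ▸ ha⟩, fun h => hm' (h ▸ Finset.mem_image_of_mem _ ha)⟩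
  refine ⟨insert (m, m') p, Finset.subset_insert _ _, ⟨fun a ha b hb => ?_, fun n t ht h h' => ?_⟩,
    m', Finset.mem_insert_self _ _⟩
  · rcases Finset.mem_insert.1 ha with rfl | ha <;> rcases Finset.mem_insert.1 hb with rfl | hb
    · simp
    · simp [(hpm b hb).1.symm, (hpm b hb).2.symm]
    · simp [(hpm a ha).1, (hpm a ha).2]
    · exact hp.1 a ha b hb
  · by_cases hall : ∀ i, t i ∈ p
    · exact hp.2 n t hall h h'
    have old : ∀ i, t i ≠ (m, m') → t i ∈ p := fun i hi =>
      (Finset.mem_insert.1 (ht i)).resolve_left hi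
    let t' : Fin (n + 1) → Option M := fun i => if t i = (m, m') then none else some (t i).2
    have ht'₁ : ∀ i, u (t' i) = (t i).1 := fun i => by
      by_cases hi : t i = (m, m')
      · simp [t', hi, u]
      · simp only [t', if_neg hi]
        exact hu _ (old i hi)
    have ht'₂ : (fun i => (t' i).getD m') = Prod.snd ∘ t := by
      funext i
      by_cases hi : t i = (m, m') <;> simp [t', hi]
    have ht' : Function.Injective t' := fun i j hij => h (by
      change (t i).1 = (t j).1
      rw [← ht'₁, ← ht'₁, hij])
    obtain ⟨h₁, h₂⟩ := H n t' ht' fun i x hx => by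
      by_cases hi : t i = (m, m')
      · simp [t', hi] at hx
      · simp only [t', if_neg hi, Option.mem_def, Option.some.injEq] at hx
        exact hx ▸ Finset.mem_image_of_mem _ (old i hi)
    rw [← eProj_congr ht'₂ h₁ h', h₂]
    have hn : ¬ ∃ a : Fin (n + 1) → M, Function.Injective a ∧ t' = some ∘ a := by
      rintro ⟨a, -, ha⟩
      push Not at hall
      obtain ⟨i, hi⟩ := hall
      have hi' : t i = (m, m') := by
        by_contra h
        exact hi (old i h)
      have := congrFun ha i
      simp [t', hi'] at this
    have hut : u ∘ t' = Prod.fst ∘ t := funext ht'₁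
    have hut' : Function.Injective (u ∘ t') := hut ▸ h
    simp only [κ, dif_neg hn, dif_pos hut']
    rw [eProj_congr hut hut' h]

/-- The automorphism group of the universal homogeneous structure induces all families of
permutations of the sorts. -/
theorem exists_perm_eProj_comp [Countable M] [Infinite M] (hM : IsFraisseLimit classE M)
    (f : ∀ n, Equiv.Perm (ESort n M)) :
    ∃ g : Equiv.Perm M, ∀ n (a : Fin (n + 1) → M) (h : Function.Injective a),
      eProj (g ∘ a) (g.injective.comp h) = f n (eProj a h) := by
  classical
  let _ := Encodable.ofCountable M
  let P := {p : Finset (M × M) // IsPartialLift f p}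
  -- Countably many requirements: each element must enter the domain and the range.
  let 𝒟 : M ⊕ M → Order.Cofinal P := Sum.elim
    (fun m => ⟨{p | ∃ m', (m, m') ∈ p.1}, fun p => by
      obtain ⟨p', h₁, h₂, h₃⟩ := p.2.exists_extension hM m
      exact ⟨⟨p', h₂⟩, h₃, h₁⟩⟩)
    (fun m' => ⟨{p | ∃ m, (m, m') ∈ p.1}, fun p => by
      obtain ⟨p', h₁, h₂, m, h₃⟩ := p.2.symm.exists_extension hM m'
      refine ⟨⟨p'.image Prod.swap, by simpa using h₂.symm⟩,
        ⟨m, Finset.mem_image.2 ⟨_, h₃, rfl⟩⟩, fun a ha => ?_⟩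
      exact Finset.mem_image.2 ⟨a.swap, h₁ (Finset.mem_image_of_mem _ ha), by simp⟩⟩)
  let p₀ : P := ⟨∅, by simp, fun n t ht => absurd (ht 0) (by simp)⟩
  let S : ℕ → P := Order.sequenceOfCofinals p₀ 𝒟
  have hS : ∀ {i j}, i ≤ j → (S i).1 ⊆ (S j).1 := fun h =>
    Order.sequenceOfCofinals.monotone p₀ 𝒟 h
  have h₁ : ∀ m, ∃ m' k, (m, m') ∈ (S k).1 := fun m => by
    obtain ⟨m', h⟩ := Order.sequenceOfCofinals.encode_mem p₀ 𝒟 (Sum.inl m)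
    exact ⟨m', _, h⟩
  have h₂ : ∀ m', ∃ m k, (m, m') ∈ (S k).1 := fun m' => by
    obtain ⟨m, h⟩ := Order.sequenceOfCofinals.encode_mem p₀ 𝒟 (Sum.inr m')
    exact ⟨m, _, h⟩
  have h₃ : ∀ {k l a b}, a ∈ (S k).1 → b ∈ (S l).1 → (a.1 = b.1 ↔ a.2 = b.2) :=
    fun {k l a b} ha hb => (S (max k l)).2.1 a (hS (le_max_left _ _) ha) b
      (hS (le_max_right _ _) hb)
  choose g k hg using h₁
  have hbij : Function.Bijective g := by
    refine ⟨fun x y hxy => (h₃ (hg x) (hg y)).2 hxy, fun y => ?_⟩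
    obtain ⟨x, l, hx⟩ := h₂ y
    exact ⟨x, (h₃ (hg x) hx).1 rfl⟩
  refine ⟨Equiv.ofBijective g hbij, fun n a h => ?_⟩
  refine ((S (Finset.univ.sup (k ∘ a))).2.2 n (fun i => (a i, g (a i))) (fun i => ?_) h
    (hbij.1.comp h)).symm
  exact hS (Finset.le_sup (f := k ∘ a) (Finset.mem_univ i)) (hg (a i))

/-- The hypothesis governs only tuples without repetitions. The tuples with a repetition form one
class by themselves, and every bijection preserves that class. -/
theorem eRel_comp_perm_iff (hE : IsEStructure M) {f : ∀ n, Equiv.Perm (ESort n M)}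
    {g : Equiv.Perm M} (hg : ∀ n (a : Fin (n + 1) → M) (h : Function.Injective a),
      eProj (g ∘ a) (g.injective.comp h) = f n (eProj a h)) {n : ℕ} (a b : Fin (n + 1) → M) :
    eRel (g ∘ a) (g ∘ b) ↔ eRel a b := by
  by_cases ha : Function.Injective a
  · by_cases hb : Function.Injective b
    · rw [← hE.eProj_eq_iff (h := g.injective.comp ha) (h' := g.injective.comp hb), hg n a ha,
        hg n b hb, (f n).injective.eq_iff, hE.eProj_eq_iff]
    · have h₁ := (hE n).2 b a hb
      have h₂ := (hE n).2 (g ∘ b) (g ∘ a) (fun h => hb h.of_comp)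
      rw [g.injective.of_comp_iff] at h₂
      exact ⟨fun h => (hE n).1.symm (h₁.2 (h₂.1 ((hE n).1.symm h))),
        fun h => (hE n).1.symm (h₂.2 (h₁.1 ((hE n).1.symm h)))⟩
  · rw [(hE n).2 a b ha, (hE n).2 (g ∘ a) (g ∘ b) (fun h => ha h.of_comp),
      g.injective.of_comp_iff]

end FraisseLimit

/-! ### Canonical pieces that are orbits -/

theorem smul_mem_saturation_iff {G X : Type*} [Group G] [MulAction G X] {A : Set X} (g : G)
    {x : X} : g • x ∈ saturation G A ↔ x ∈ saturation G A := by
  constructor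
  · rintro ⟨h, a, ha, hx⟩
    exact ⟨g⁻¹ * h, a, ha, by rw [mul_smul, hx, inv_smul_smul]⟩
  · rintro ⟨h, a, ha, rfl⟩
    exact ⟨g * h, a, ha, mul_smul _ _ _⟩

/-- Saturations are invariant, so all points of an orbit have the same function `t`; the hypothesis
says that no other point has it. -/
theorem isCanonicalPiece_orbit {G X ι : Type*} [Group G] [MulAction G X] (A : ι → Set X) (x : X)
    (h : ∀ y, (∀ j, y ∈ saturation G (A j) ↔ x ∈ saturation G (A j)) → y ∈ MulAction.orbit G x) :
    IsCanonicalPiece G A (MulAction.orbit G x) := by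
  classical
  refine ⟨⟨x, MulAction.mem_orbit_self x⟩, fun j => decide (x ∈ saturation G (A j)), ?_⟩
  ext y
  simp only [Set.mem_inter_iff, Set.mem_iInter, Set.mem_ofPred_eq, decide_eq_true_eq,
    decide_eq_false_iff_not, Set.mem_compl_iff]
  constructor
  · rintro ⟨g, rfl⟩
    exact ⟨fun j hj => (smul_mem_saturation_iff g).2 hj,
      fun j hj h => hj ((smul_mem_saturation_iff g).1 h)⟩
  · rintro ⟨h₁, h₂⟩
    exact h y fun j => ⟨fun hy => by_contra fun hx => h₂ j hx hy, h₁ j⟩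

/-! ### The space of expansions -/

section Expansions

variable {LN : FirstOrder.Language.{0, 0}} {N : Type} [LN.Structure N] [langE.Structure ℕ]
  [LN.Structure ℕ]

theorem expansions_ext {x y : Expansions LN N} (h : ∀ n i a, pRel x.1 n i a ↔ pRel y.1 n i a) :
    x = y := by
  apply Subtype.ext
  apply Structure.ext
  · funext n f
    exact f.elim
  · funext k (R : PRel k) a
    cases R with
    | P n i => exact propext (h n i a)

/-- The expansion in which the new symbols are interpreted by the given sets of classes. -/
def expansionOf (hM : IsBaseStructure LN N ℕ) (U : ∀ n, ℕ → Set (ESort (n + 1) ℕ)) :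
    Expansions LN N :=
  letI x : langP.Structure ℕ :=
    { funMap := fun f => isEmptyElim (α := Empty) f
      RelMap := fun {k} (R : PRel k) => match k, R with
        | _, PRel.P n i => fun a => ∃ h : Function.Injective a, eProj a h ∈ U n i }
  ⟨x, ⟨fun _ hφ => hφ ℕ ⟨hM, U, fun _ _ _ => Iff.rfl⟩⟩⟩

theorem pRel_expansionOf (hM : IsBaseStructure LN N ℕ) (U : ∀ n, ℕ → Set (ESort (n + 1) ℕ))
    (n i : ℕ) (a : Fin (n + 2) → ℕ) :
    pRel (expansionOf hM U).1 n i a ↔ ∃ h : Function.Injective a, eProj a h ∈ U n i :=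
  Iff.rfl

/-- A point of the space is only known to be a model of `T`. The invariance is therefore expressed
by the universal sentence `P(x) → E(x, y) → P(y)`, which belongs to `T` because it holds in all
structures `M*`. -/
theorem pRel_congr_of_eRel (x : Expansions LN N) {n i : ℕ} {a b : Fin (n + 2) → ℕ}
    (hab : eRel a b) (ha : pRel x.1 n i a) : pRel x.1 n i b := by
  let φ : (langFull LN).BoundedFormula Empty ((n + 2) + (n + 2)) :=
    Relations.boundedFormula (L := langFull LN) (Sum.inr (PRel.P n i))
        (fun j => (Term.var (Sum.inr (Fin.castAdd (n + 2) j)))) ⟹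
      (Relations.boundedFormula (L := langFull LN) (Sum.inl (Sum.inl (ERel.E (n + 1))))
          (fun j => (Term.var (Sum.inr j))) ⟹
        Relations.boundedFormula (L := langFull LN) (Sum.inr (PRel.P n i))
          (fun j => (Term.var (Sum.inr (Fin.natAdd (n + 2) j)))))
  have hφ : φ.alls ∈ starTheory LN N := by
    intro M _ _ _ _ hM
    obtain ⟨hM, U, hU⟩ := hM
    have hE := isEStructure_of_isFraisseLimit hM.1
    refine BoundedFormula.realize_alls.2 fun v => ?_
    simp only [φ, BoundedFormula.realize_imp]
    intro (h₁ : pRel _ n i (v ∘ Fin.castAdd (n + 2)))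
      (h₂ : Structure.RelMap (L := langE) (ERel.E (n + 1)) v)
    change pRel _ n i (v ∘ Fin.natAdd (n + 2))
    have h₃ : eRel (n := n + 1) (v ∘ Fin.castAdd (n + 2)) (v ∘ Fin.natAdd (n + 2)) := by
      unfold eRel
      rw [append_castAdd_natAdd]
      exact h₂
    rw [hU] at h₁ ⊢
    obtain ⟨h, h₄⟩ := h₁
    have h' : Function.Injective (v ∘ Fin.natAdd (n + 2)) := by
      by_contra h'
      exact ((hE (n + 1)).2 _ _ h').1 ((hE (n + 1)).1.symm h₃) h
    refine ⟨h', ?_⟩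
    rw [← hE.eProj_eq_iff (h := h) (h' := h')] at h₃
    rwa [← h₃]
  let _ := x.1
  have := BoundedFormula.realize_alls.1 (x.2.realize_of_mem _ hφ) (Fin.append a b)
  simp only [φ, BoundedFormula.realize_imp] at this
  have h₁ : Fin.append a b ∘ Fin.castAdd (n + 2) = a := funext (Fin.append_left a b)
  have h₂ : Fin.append a b ∘ Fin.natAdd (n + 2) = b := funext (Fin.append_right a b)
  have h₃ : pRel x.1 n i (Fin.append a b ∘ Fin.castAdd (n + 2)) →
    Structure.RelMap (L := langE) (ERel.E (n + 1)) (Fin.append a b) →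
    pRel x.1 n i (Fin.append a b ∘ Fin.natAdd (n + 2)) := this
  rw [h₁, h₂] at h₃
  exact h₃ ha hab

/-- Again a universal sentence of `T`: for each pair of distinct positions, `P(x)` implies that
these coordinates differ. -/
theorem injective_of_pRel (x : Expansions LN N) {n i : ℕ} {a : Fin (n + 2) → ℕ}
    (ha : pRel x.1 n i a) : Function.Injective a := by
  intro j k hjk
  by_contra hne
  let φ : (langFull LN).BoundedFormula Empty (n + 2) :=
    Relations.boundedFormula (L := langFull LN) (Sum.inr (PRel.P n i))
        (fun j => (Term.var (Sum.inr j))) ⟹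
      ∼((Term.var (Sum.inr j) : (langFull LN).Term (Empty ⊕ Fin (n + 2))) =' Term.var (Sum.inr k))
  have hφ : φ.alls ∈ starTheory LN N := by
    intro M _ _ _ _ hM
    obtain ⟨hM, U, hU⟩ := hM
    refine BoundedFormula.realize_alls.2 fun v => ?_
    simp only [φ, BoundedFormula.realize_imp, BoundedFormula.realize_not,
       BoundedFormula.realize_bdEqual, Term.realize_var, Sum.elim_inr]
    intro (h₁ : pRel _ n i v) h₂
    rw [hU] at h₁
    exact hne (h₁.1 h₂)
  let _ := x.1
  have := BoundedFormula.realize_alls.1 (x.2.realize_of_mem _ hφ) a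
  simp only [φ, BoundedFormula.realize_imp, BoundedFormula.realize_not,
    BoundedFormula.realize_bdEqual, Term.realize_var,
    Sum.elim_inr] at this
  exact this ha hjk

theorem pRel_smul (g : autGroup (langZero LN)) (x : Expansions LN N) {n i : ℕ}
    {a : Fin (n + 2) → ℕ} : pRel (g • x).1 n i a ↔ pRel x.1 n i (g.1.symm ∘ a) :=
  Iff.rfl

theorem eRel_comp_autGroup (g : autGroup (langZero LN)) {n : ℕ} (a b : Fin (n + 1) → ℕ) :
    eRel (g.1 ∘ a) (g.1 ∘ b) ↔ eRel a b := by
  unfold eRel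
  rw [← comp_append_fin]
  exact g.2.2 _ (Sum.inl (ERel.E n)) _

theorem mem_saturation_basicSet {x : Expansions LN N} {D : DiagramCode} :
    x ∈ saturation (autGroup (langZero LN)) (basicSet D) ↔ ∃ g : autGroup (langZero LN),
      ∀ p ∈ D.2.1, ∀ b : Fin (p.1 + 2) → ℕ, (∀ j, b j ∈ D.1) →
        (pRel x.1 p.1 p.2 (g.1 ∘ b) ↔ (p, List.ofFn b) ∈ D.2.2) := by
  have key : ∀ (g : autGroup (langZero LN)) (y : Expansions LN N) {n i : ℕ}
      (b : Fin (n + 2) → ℕ), pRel (g • y).1 n i (g.1 ∘ b) ↔ pRel y.1 n i b := by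
    intro g y n i b
    rw [pRel_smul, ← Function.comp_assoc, Equiv.symm_comp_self, Function.id_comp]
  constructor
  · rintro ⟨g, y, hy, rfl⟩
    exact ⟨g, fun p hp b hb => (key g y b).trans (hy p hp b hb)⟩
  · rintro ⟨g, hg⟩
    refine ⟨g, g⁻¹ • x, fun p hp b hb => ?_, smul_inv_smul g x⟩
    rw [← hg p hp b hb, ← key g (g⁻¹ • x), smul_inv_smul]

theorem exists_facts (y : Expansions LN N) (L : List ℕ) (p : ℕ × ℕ) :
    ∃ F : List ((ℕ × ℕ) × List ℕ), ∀ b : Fin (p.1 + 2) → ℕ, (∀ j, b j ∈ L) →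
      (pRel y.1 p.1 p.2 b ↔ (p, List.ofFn b) ∈ F) := by
  classical
  refine ⟨((tuplesFrom L (p.1 + 2)).filter fun l =>
    ∃ b, List.ofFn b = l ∧ pRel y.1 p.1 p.2 b).map fun l => (p, l), fun b hb => ?_⟩
  have hL : List.ofFn b ∈ tuplesFrom L (p.1 + 2) := by
    rw [mem_tuplesFrom]
    exact ⟨List.length_ofFn, List.forall_mem_ofFn_iff.2 hb⟩
  simp only [List.mem_map, List.mem_filter, decide_eq_true_eq, Prod.mk.injEq, true_and,
    exists_eq_right, hL]
  constructor
  · exact fun h => ⟨b, rfl, h⟩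
  · rintro ⟨b', h, h'⟩
    rwa [← List.ofFn_injective h]

/-- The complete diagram of `y` on `L` for one symbol is a basic set containing `y`; that `x` lies
in its saturation means that some translate of `L` has the same diagram in `x`. The automorphism
depends on the symbol and on `L`. -/
theorem exists_autGroup_pRel_iff {x y : Expansions LN N}
    (h : ∀ D, y ∈ saturation (autGroup (langZero LN)) (basicSet D) →
      x ∈ saturation (autGroup (langZero LN)) (basicSet D)) (L : List ℕ) (n i : ℕ) :
    ∃ g : autGroup (langZero LN), ∀ b : Fin (n + 2) → ℕ, (∀ j, b j ∈ L) →
      (pRel x.1 n i (g.1 ∘ b) ↔ pRel y.1 n i b) := by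
  obtain ⟨F, hF⟩ := exists_facts y L (n, i)
  have hy : y ∈ saturation (autGroup (langZero LN)) (basicSet (L, [(n, i)], F)) := by
    refine mem_saturation_basicSet.2 ⟨1, fun p hp b hb => ?_⟩
    obtain rfl := List.mem_singleton.1 hp
    exact hF b hb
  obtain ⟨g, hg⟩ := mem_saturation_basicSet.1 (h _ hy)
  exact ⟨g, fun b hb => (hg (n, i) (List.mem_singleton_self _) b hb).trans (hF b hb).symm⟩

theorem satSet_injective : Function.Injective (satSet : Expansions LN N → Set ℕ) := by
  intro x y hxy
  refine expansions_ext fun n i a => ?_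
  obtain ⟨F, hF⟩ := exists_facts x (List.ofFn a) (n, i)
  have hx : x ∈ basicSet (List.ofFn a, [(n, i)], F) := by
    intro p hp b hb
    obtain rfl := List.mem_singleton.1 hp
    exact hF b hb
  have : Encodable.encode (List.ofFn a, [(n, i)], F) ∈ satSet y := hxy ▸ ⟨_, rfl, hx⟩
  obtain ⟨D, hD, hy⟩ := this
  obtain rfl := Encodable.encode_injective hD
  have ha : ∀ j, a j ∈ List.ofFn a := fun j => List.mem_ofFn.2 ⟨j, rfl⟩
  exact (hF a ha).trans (hy (n, i) (List.mem_singleton_self _) a ha).symm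

/-! ### Invariant expansions -/

/-- The expansion in which the `i`-th binary symbol holds of all pairs of distinct elements if
`i ∈ D`, and all other new symbols are empty. -/
def fullExpansion (hM : IsBaseStructure LN N ℕ) (D : Set ℕ) : Expansions LN N :=
  expansionOf hM fun n i => {_s | n = 0 ∧ i ∈ D}

theorem pRel_fullExpansion (hM : IsBaseStructure LN N ℕ) {D : Set ℕ} {n i : ℕ}
    {a : Fin (n + 2) → ℕ} :
    pRel (fullExpansion hM D).1 n i a ↔ Function.Injective a ∧ n = 0 ∧ i ∈ D :=
  (pRel_expansionOf _ _ _ _ _).trans exists_prop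

theorem smul_fullExpansion (hM : IsBaseStructure LN N ℕ) (D : Set ℕ)
    (g : autGroup (langZero LN)) : g • fullExpansion hM D = fullExpansion hM D :=
  expansions_ext fun n i a => by
    rw [pRel_smul, pRel_fullExpansion, pRel_fullExpansion, g.1.symm.injective.of_comp_iff]

theorem mem_orbit_fullExpansion (hM : IsBaseStructure LN N ℕ) {D : Set ℕ} {y : Expansions LN N} :
    y ∈ MulAction.orbit (autGroup (langZero LN)) (fullExpansion hM D) ↔
      y = fullExpansion hM D := by
  constructor
  · rintro ⟨g, rfl⟩
    exact smul_fullExpansion hM D g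
  · rintro rfl
    exact MulAction.mem_orbit_self _

/-- Each fact about a tuple in `y` is a fact about a translate of the tuple in the full expansion,
where it depends only on the symbol and on the absence of repetitions. -/
theorem isCanonicalPiece_fullExpansion (hM : IsBaseStructure LN N ℕ) (D : Set ℕ) :
    IsCanonicalPiece (autGroup (langZero LN)) basicSet
      (MulAction.orbit (autGroup (langZero LN)) (fullExpansion hM D)) := by
  refine isCanonicalPiece_orbit _ _ fun y hy => (mem_orbit_fullExpansion hM).2 ?_
  refine expansions_ext fun n i a => ?_
  obtain ⟨g, hg⟩ := exists_autGroup_pRel_iff (fun D => (hy D).1) (List.ofFn a) n i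
  rw [← hg a fun j => List.mem_ofFn.2 ⟨j, rfl⟩, pRel_fullExpansion, pRel_fullExpansion,
    g.1.injective.of_comp_iff]

/-! ### Expansions by single classes -/

/-- The expansion in which the first symbol of arity `n + 2` is interpreted by the class `c n`,
if there is one, and all other new symbols are empty. -/
def classExpansion (hM : IsBaseStructure LN N ℕ) (c : ∀ n, Option (ESort (n + 1) ℕ)) :
    Expansions LN N :=
  expansionOf hM fun n i => {s | i = 0 ∧ c n = some s}

theorem pRel_classExpansion (hM : IsBaseStructure LN N ℕ) {c : ∀ n, Option (ESort (n + 1) ℕ)}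
    {n i : ℕ} {a : Fin (n + 2) → ℕ} :
    pRel (classExpansion hM c).1 n i a ↔
      ∃ h : Function.Injective a, i = 0 ∧ c n = some (eProj a h) :=
  Iff.rfl

theorem exists_eProj_eq {n : ℕ} (s : ESort n ℕ) :
    ∃ (a : Fin (n + 1) → ℕ) (h : Function.Injective a), eProj a h = s := by
  obtain ⟨⟨a, h⟩, rfl⟩ := Quot.exists_rep s
  exact ⟨a, h, rfl⟩

/-- Automorphisms that fix all `E_1`-classes and permute the other classes arbitrarily. -/
theorem exists_autGroup_eProj_comp (hM : IsBaseStructure LN N ℕ) [LN.IsRelational]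
    (f : ∀ n, Equiv.Perm (ESort (n + 1) ℕ)) :
    ∃ g : autGroup (langZero LN), ∀ n (a : Fin (n + 2) → ℕ) (h : Function.Injective a),
      eProj (g.1 ∘ a) (g.1.injective.comp h) = f n (eProj a h) := by
  -- The identity on the sort of `E_1`-classes ensures that the symbols of `L_N`, which are pulled
  -- back from this sort, are preserved.
  let f' : ∀ n, Equiv.Perm (ESort n ℕ) := fun n => match n with
    | 0 => 1
    | n + 1 => f n
  obtain ⟨g, hg⟩ := exists_perm_eProj_comp hM.1 f'
  have hE := isEStructure_of_isFraisseLimit hM.1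
  obtain ⟨S, -, hS⟩ := hM.2
  refine ⟨⟨g, fun n φ => isEmptyElim φ, fun n R a => ?_⟩, fun n => hg (n + 1)⟩
  rcases R with R | R
  · obtain ⟨n⟩ : ERel n := R
    have := eRel_comp_perm_iff hE hg (a ∘ Fin.castAdd (_ + 1)) (a ∘ Fin.natAdd (_ + 1))
    unfold eRel at this
    rwa [← comp_append_fin, append_castAdd_natAdd] at this
  · have h₁ : ∀ m, eProjOne (g m) = eProjOne m := fun m =>
      hg 0 (fun _ => m) fun i j _ => Subsingleton.elim (α := Fin 1) i j
    have : Structure.RelMap R (g ∘ a) ↔ Structure.RelMap R a := by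
      rw [hS, hS]
      simp only [Function.comp_apply, h₁]
    exact this

/-- In each sort a transposition moves the one chosen class to the other, and these transpositions
lift simultaneously to one automorphism. -/
theorem classExpansion_mem_orbit (hM : IsBaseStructure LN N ℕ) [LN.IsRelational]
    {c c' : ∀ n, Option (ESort (n + 1) ℕ)} (h : ∀ n, (c n).isSome = (c' n).isSome) :
    classExpansion hM c' ∈
      MulAction.orbit (autGroup (langZero LN)) (classExpansion hM c) := by
  classical
  have hf : ∀ n, ∃ f : Equiv.Perm (ESort (n + 1) ℕ), c' n = (c n).map f := fun n => by
    have := h n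
    cases hc : c n with
    | none =>
      cases hc' : c' n with
      | none => exact ⟨1, rfl⟩
      | some s' => simp [hc, hc'] at this
    | some s =>
      cases hc' : c' n with
      | none => simp [hc, hc'] at this
      | some s' => exact ⟨Equiv.swap s s', by simp⟩
  choose f hf using hf
  obtain ⟨g, hg⟩ := exists_autGroup_eProj_comp hM f
  refine ⟨g, expansions_ext fun n i a => ?_⟩
  change pRel (g • classExpansion hM c).1 n i a ↔ _
  rw [pRel_smul, pRel_classExpansion, pRel_classExpansion]
  have ha : g.1 ∘ (g.1.symm ∘ a) = a := by
    rw [← Function.comp_assoc, Equiv.self_comp_symm, Function.id_comp]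
  have key : ∀ (h₁ : Function.Injective (g.1.symm ∘ a)) (h₂ : Function.Injective a),
      c n = some (eProj _ h₁) ↔ c' n = some (eProj _ h₂) := fun h₁ h₂ => by
    rw [hf n, ← eProj_congr ha (g.1.injective.comp h₁) h₂, hg n _ h₁,
      Option.map_eq_some_iff]
    simp
  constructor
  · rintro ⟨h₁, h₂, h₃⟩
    have h₄ : Function.Injective a := h₁.of_comp
    exact ⟨h₄, h₂, (key h₁ h₄).1 h₃⟩
  · rintro ⟨h₁, h₂, h₃⟩
    have h₄ := g.1.symm.injective.comp h₁
    exact ⟨h₄, h₂, (key h₄ h₁).2 h₃⟩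

theorem exists_pRel_classExpansion_iff (hM : IsBaseStructure LN N ℕ)
    {c : ∀ n, Option (ESort (n + 1) ℕ)} {n : ℕ} :
    (∃ a, pRel (classExpansion hM c).1 n 0 a) ↔ (c n).isSome := by
  rw [Option.isSome_iff_exists]
  constructor
  · rintro ⟨a, h, -, ha⟩
    exact ⟨_, ha⟩
  · rintro ⟨s, hs⟩
    obtain ⟨a, h, rfl⟩ := exists_eProj_eq s
    exact ⟨a, h, rfl, hs⟩

theorem exists_pRel_iff_of_mem_orbit {x y : Expansions LN N}
    (h : y ∈ MulAction.orbit (autGroup (langZero LN)) x) {n i : ℕ} :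
    (∃ a, pRel y.1 n i a) ↔ ∃ a, pRel x.1 n i a := by
  obtain ⟨g, rfl⟩ := h
  constructor
  · rintro ⟨a, ha⟩
    exact ⟨_, ha⟩
  · rintro ⟨a, ha⟩
    refine ⟨g.1 ∘ a, (pRel_smul g x).2 ?_⟩
    rwa [← Function.comp_assoc, Equiv.symm_comp_self, Function.id_comp]

/-- A point `y` of the same piece has only the symbols with `i = 0` non-empty, each of them holds on
at most one class (two tuples are compared in one diagram), and it is non-empty exactly when `c`
makes a choice. So `y` is itself a class expansion, with the same domain. -/
theorem isCanonicalPiece_classExpansion (hM : IsBaseStructure LN N ℕ) [LN.IsRelational]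
    (c : ∀ n, Option (ESort (n + 1) ℕ)) :
    IsCanonicalPiece (autGroup (langZero LN)) basicSet
      (MulAction.orbit (autGroup (langZero LN)) (classExpansion hM c)) := by
  classical
  refine isCanonicalPiece_orbit _ _ fun y hy => ?_
  have hE := isEStructure_of_isFraisseLimit hM.1
  have hyx := exists_autGroup_pRel_iff fun D => (hy D).1
  have hxy := exists_autGroup_pRel_iff fun D => (hy D).2
  have h₁ : ∀ n i a, pRel y.1 n i a → i = 0 := fun n i a ha => by
    obtain ⟨g, hg⟩ := hyx (List.ofFn a) n i
    exact ((hg a fun j => List.mem_ofFn.2 ⟨j, rfl⟩).2 ha).2.1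
  have h₂ : ∀ n (a b : Fin (n + 2) → ℕ), pRel y.1 n 0 a → pRel y.1 n 0 b →
      eRel (n := n + 1) a b := fun n a b ha hb => by
    obtain ⟨g, hg⟩ := hyx (List.ofFn a ++ List.ofFn b) n 0
    obtain ⟨ia, -, ha'⟩ := (hg a fun j => List.mem_append_left _ (List.mem_ofFn.2 ⟨j, rfl⟩)).2 ha
    obtain ⟨ib, -, hb'⟩ := (hg b fun j => List.mem_append_right _ (List.mem_ofFn.2 ⟨j, rfl⟩)).2 hb
    rw [ha', Option.some.injEq, hE.eProj_eq_iff] at hb'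
    exact (eRel_comp_autGroup g a b).1 hb'
  have h₃ : ∀ n, (∃ a, pRel y.1 n 0 a) ↔ (c n).isSome := fun n => by
    rw [← exists_pRel_classExpansion_iff hM]
    constructor
    · rintro ⟨a, ha⟩
      obtain ⟨g, hg⟩ := hyx (List.ofFn a) n 0
      exact ⟨_, (hg a fun j => List.mem_ofFn.2 ⟨j, rfl⟩).2 ha⟩
    · rintro ⟨a, ha⟩
      obtain ⟨g, hg⟩ := hxy (List.ofFn a) n 0
      exact ⟨_, (hg a fun j => List.mem_ofFn.2 ⟨j, rfl⟩).2 ha⟩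
  let c' : ∀ n, Option (ESort (n + 1) ℕ) := fun n =>
    if h : ∃ a, pRel y.1 n 0 a then
      some (eProj (n := n + 1) h.choose (injective_of_pRel y h.choose_spec)) else none
  have hc' : ∀ n, (c n).isSome = (c' n).isSome := fun n => by
    rw [Bool.eq_iff_iff, ← h₃]
    by_cases h : ∃ a, pRel y.1 n 0 a <;> simp [c', h]
  have : y = classExpansion hM c' := expansions_ext fun n i a => by
    rw [pRel_classExpansion]
    constructor
    · intro ha
      obtain rfl := h₁ n i a ha
      have h : ∃ a, pRel y.1 n 0 a := ⟨a, ha⟩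
      refine ⟨injective_of_pRel y ha, rfl, ?_⟩
      simp only [c', dif_pos h, Option.some.injEq, hE.eProj_eq_iff]
      exact h₂ n _ _ h.choose_spec ha
    · rintro ⟨ia, rfl, ha⟩
      by_cases h : ∃ a, pRel y.1 n 0 a
      · simp only [c', dif_pos h, Option.some.injEq, hE.eProj_eq_iff] at ha
        exact pRel_congr_of_eRel y ha h.choose_spec
      · simp [c', h] at ha
  rw [this]
  exact classExpansion_mem_orbit hM hc'

end Expansions

/-! ### Decidability of the relations `E_n` -/

/-- The Gödel number of the atomic formula `E(l, l')`. -/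
def eRelCode (l l' : List ℕ) : ℕ :=
  Nat.pair 2 (Nat.pair (2 * (l.length - 1)) (Encodable.encode ((l ++ l').map fun k => 2 * k)))

theorem computable₂_eRelCode : Computable₂ eRelCode := by
  refine Primrec.to_comp (f := fun q : List ℕ × List ℕ => eRelCode q.1 q.2) ?_
  refine Primrec₂.natPair.comp (Primrec.const 2) (Primrec₂.natPair.comp
    (Primrec.nat_double.comp (Primrec.nat_sub.comp (Primrec.list_length.comp Primrec.fst)
      (Primrec.const 1))) (Primrec.encode.comp ?_))
  exact Primrec.list_map (Primrec.list_append.comp Primrec.fst Primrec.snd)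
    (Primrec.nat_double.comp Primrec.snd)

theorem realize_of_termCode_eq {L : FirstOrder.Language.{0, 0}} [L.IsRelational] [L.Structure ℕ]
    (t : L.Term (ℕ ⊕ Fin 0)) {k : ℕ} (h : termCode t = 2 * k) (v : Fin 0 → ℕ) :
    t.realize (Sum.elim id v) = k := by
  rcases t with (a | i) | ⟨f, ts⟩
  · simp only [termCode, Encodable.encode_nat] at h
    simp only [Term.realize_var, Sum.elim_inl, id]
    omega
  · exact i.elim0
  · exact isEmptyElim f

/-- The code determines the formula up to what matters: tag `2` means atomic, an even symbol number
means a symbol of `L_E`, and an even term code means a parameter. The symbol for `(n + 1)`-tuples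
has index `n`, one less than the length. -/
theorem exists_formulaCode_eq_eRelCode_iff {LN : FirstOrder.Language.{0, 0}} [LN.IsRelational]
    (c : (Σ n, LN.Relations n) → ℕ) [langE.Structure ℕ] [LN.Structure ℕ] {n : ℕ}
    (a b : Fin (n + 1) → ℕ) :
    (∃ φ : (langZero LN).Formula ℕ, formulaCode (symCodeZero c) φ =
      eRelCode (List.ofFn a) (List.ofFn b) ∧ φ.Realize id) ↔ eRel a b := by
  have hcode : eRelCode (List.ofFn a) (List.ofFn b) = Nat.pair 2 (Nat.pair (2 * n)
      (Encodable.encode (List.ofFn fun i => 2 * Fin.append a b i))) := by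
    unfold eRelCode
    rw [← List.ofFn_fin_append, List.map_ofFn]
    simp
  rw [hcode]
  constructor
  · rintro ⟨φ, hφ, hr⟩
    cases φ with
    | falsum => simp [formulaCode, Nat.pair_eq_pair] at hφ
    | equal s t => simp [formulaCode, Nat.pair_eq_pair] at hφ
    | imp φ ψ => simp [formulaCode, Nat.pair_eq_pair] at hφ
    | all φ => simp [formulaCode, Nat.pair_eq_pair] at hφ
    | rel R ts =>
      simp only [formulaCode, Nat.pair_eq_pair, true_and] at hφ
      obtain ⟨h₁, h₂⟩ := hφ
      rcases R with R | R
      · obtain ⟨n'⟩ : ERel _ := R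
        obtain rfl : n' = n := by
          simp only [symCodeZero, ERel.index] at h₁
          omega
        have h₃ := congrFun (List.ofFn_injective (Encodable.encode_injective h₂))
        obtain ⟨v, h₄⟩ : ∃ v : Fin 0 → ℕ, Structure.RelMap (L := langE) (ERel.E n')
            fun i => (ts i).realize (Sum.elim id v) := ⟨_, hr⟩
        have h₅ : (fun i => (ts i).realize (Sum.elim id v)) = Fin.append a b :=
          funext fun i => realize_of_termCode_eq (ts i) (h₃ i) v
        rw [h₅] at h₄
        exact h₄
      · simp only [symCodeZero] at h₁
        omega
  · intro h
    refine ⟨BoundedFormula.rel (L := langZero LN) (Sum.inl (ERel.E n))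
      (fun i => Term.var (Sum.inl (Fin.append a b i))), ?_, h⟩
    simp [formulaCode, symCodeZero, ERel.index, termCode]

theorem exists_computable_eRel {LN : FirstOrder.Language.{0, 0}} [LN.IsRelational]
    (c : (Σ n, LN.Relations n) → ℕ) [langE.Structure ℕ] [LN.Structure ℕ]
    (hMdec : HasDecidableElementaryDiagram (L := langZero LN) (symCodeZero c)) :
    ∃ e : List ℕ → List ℕ → Bool, Computable₂ e ∧
      ∀ n (a b : Fin (n + 1) → ℕ), e (List.ofFn a) (List.ofFn b) = true ↔ eRel a b := by
  obtain ⟨hd, hc⟩ := hMdec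
  refine ⟨fun l l' => decide (∃ φ : (langZero LN).Formula ℕ, formulaCode (symCodeZero c) φ =
      eRelCode l l' ∧ φ.Realize id), hc.comp computable₂_eRelCode, fun n a b => ?_⟩
  rw [decide_eq_true_iff, exists_formulaCode_eq_eRelCode_iff]

/-! ### Degrees of expansions -/

open Classical in
/-- The characteristic function of a set as a total function. -/
noncomputable def charNat (A : Set ℕ) (m : ℕ) : ℕ := if m ∈ A then 1 else 0

theorem charFun_eq (A : Set ℕ) : charFun A = fun m => Part.some (charNat A m) := rfl

theorem exists_ofFn_eq {α : Type*} {l : List α} {k : ℕ} (h : l.length = k) :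
    ∃ b : Fin k → α, List.ofFn b = l := by
  subst h
  exact ⟨l.get, List.ofFn_get l⟩

theorem le_foldr_max {l : List ℕ} {i : ℕ} (h : i ∈ l) : i ≤ l.foldr max 0 := by
  induction l with
  | nil => simp at h
  | cons a l ih =>
    rcases List.mem_cons.1 h with rfl | h
    · exact le_max_left _ _
    · exact (ih h).trans (le_max_right _ _)

/-- The characteristic function of `satSet x`, computed from the truth values of atomic facts. -/
def satFun (q : (ℕ × ℕ) × List ℕ → Bool) (m : ℕ) : ℕ :=
  (diagramHolds q (Denumerable.ofNat DiagramCode m)).toNat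

theorem computable₂_satFun {α : Type*} [Primcodable α] {q : α → (ℕ × ℕ) × List ℕ → Bool}
    (hq : Computable₂ q) : Computable₂ fun a m => satFun (q a) m := by
  have h₁ : Computable fun r : α × ℕ =>
      diagramHolds (q r.1) (Denumerable.ofNat DiagramCode r.2) :=
    (computable_diagramHolds hq).comp Computable.fst
      ((Computable.ofNat DiagramCode).comp Computable.snd)
  exact (Primrec.dom_bool Bool.toNat).to_comp.comp h₁

section Degrees

variable {LN : FirstOrder.Language.{0, 0}} {N : Type} [LN.Structure N] [langE.Structure ℕ]
  [LN.Structure ℕ]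

theorem mem_satSet_iff (x : Expansions LN N) (m : ℕ) :
    m ∈ satSet x ↔ x ∈ basicSet (Denumerable.ofNat DiagramCode m) := by
  constructor
  · rintro ⟨D, rfl, h⟩
    rwa [Denumerable.ofNat_encode]
  · exact fun h => ⟨_, Denumerable.encode_ofNat m, h⟩

/-- The values of `q` need to be correct only for the symbols that occur in `D`; this permits a `q`
computed from a finite part of an oracle. -/
theorem mem_basicSet_iff_diagramHolds {x : Expansions LN N} {q : (ℕ × ℕ) × List ℕ → Bool}
    {D : DiagramCode}
    (h : ∀ p ∈ D.2.1, ∀ b : Fin (p.1 + 2) → ℕ, q (p, List.ofFn b) = true ↔ pRel x.1 p.1 p.2 b) :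
    x ∈ basicSet D ↔ diagramHolds q D = true := by
  simp only [diagramHolds, List.all_eq_true, mem_diagramFacts, beq_iff_eq]
  constructor
  · rintro hx ⟨p, l⟩ ⟨h₁, h₂, h₃⟩
    dsimp only at h₁ h₂ h₃
    obtain ⟨b, rfl⟩ := exists_ofFn_eq h₂
    rw [Bool.eq_iff_iff, h p h₁, decide_eq_true_iff]
    exact hx p h₁ b fun j => h₃ _ (List.mem_ofFn.2 ⟨j, rfl⟩)
  · intro hD p hp b hb
    rw [← h p hp, hD (p, List.ofFn b) ⟨hp, List.length_ofFn, List.forall_mem_ofFn_iff.2 hb⟩,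
      decide_eq_true_iff]

theorem mem_basicSet_congr {x y : Expansions LN N} {D : DiagramCode}
    (h : ∀ p ∈ D.2.1, ∀ b : Fin (p.1 + 2) → ℕ, (∀ j, b j ∈ D.1) →
      (pRel x.1 p.1 p.2 b ↔ pRel y.1 p.1 p.2 b)) : x ∈ basicSet D ↔ y ∈ basicSet D :=
  forall₄_congr fun p hp b hb => by rw [h p hp b hb]

theorem charNat_satSet {x : Expansions LN N} {q : (ℕ × ℕ) × List ℕ → Bool} {m : ℕ}
    (h : ∀ p ∈ (Denumerable.ofNat DiagramCode m).2.1, ∀ b : Fin (p.1 + 2) → ℕ,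
      q (p, List.ofFn b) = true ↔ pRel x.1 p.1 p.2 b) :
    charNat (satSet x) m = satFun q m := by
  have := (mem_satSet_iff x m).trans (mem_basicSet_iff_diagramHolds h)
  unfold charNat satFun
  by_cases hm : m ∈ satSet x
  · rw [if_pos hm, this.1 hm]
    rfl
  · rw [if_neg hm, Bool.eq_false_iff.2 (mt this.2 hm)]
    rfl

/-! #### Every degree is the degree of an invariant expansion -/

theorem satSet_fullExpansion_reducible (hM : IsBaseStructure LN N ℕ) (D : Set ℕ) :
    SetTuringReducible (satSet (fullExpansion hM D)) D := by
  let q : List ℕ → (ℕ × ℕ) × List ℕ → Bool := fun s r =>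
    decide r.2.Nodup && (decide (r.1.1 = 0) && decide (s[r.1.2]? = some 1))
  have hq : Computable₂ q := by
    refine Primrec.to_comp (f := fun t : List ℕ × (ℕ × ℕ) × List ℕ => q t.1 t.2) ?_
    refine Primrec.and.comp (primrec_list_nodup.comp (Primrec.snd.comp Primrec.snd))
      (Primrec.and.comp ?_ ?_)
    · exact Primrec.eq.decide.comp (Primrec.fst.comp (Primrec.fst.comp Primrec.snd))
        (Primrec.const 0)
    · exact Primrec.eq.decide.comp (Primrec.list_getElem?.comp Primrec.fst
        (Primrec.snd.comp (Primrec.fst.comp Primrec.snd))) (Primrec.const (some 1))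
  -- A bound for the second indices of the symbols in the `m`-th diagram: this much of `D` decides
  -- the diagram.
  let b : ℕ → ℕ := fun m =>
    (((Denumerable.ofNat DiagramCode m).2.1.map Prod.snd).foldr max 0) + 1
  have hb : Computable b := by
    refine Primrec.to_comp (Primrec.succ.comp ?_)
    refine Primrec.list_foldr (h := fun _ (t : ℕ × ℕ) => max t.1 t.2)
      (Primrec.list_map (f := fun m => (Denumerable.ofNat DiagramCode m).2.1)
        (g := fun _ p => p.2) (Primrec.fst.comp (Primrec.snd.comp (Primrec.ofNat DiagramCode)))
        (Primrec.snd.comp Primrec.snd)) (Primrec.const 0)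
      (Primrec.nat_max.comp (Primrec.fst.comp Primrec.snd) (Primrec.snd.comp Primrec.snd))
  have := recursiveIn_of_initialSegment (g := charNat D) (computable₂_satFun hq) hb
  refine (RecursiveIn.iff_nat.2 this).of_eq fun m => ?_
  rw [charFun_eq]
  refine congrArg Part.some (charNat_satSet fun p hp a => ?_).symm
  have hlt : p.2 < b m := Nat.lt_succ_of_le (le_foldr_max (List.mem_map_of_mem hp))
  simp only [q, pRel_fullExpansion, getElem?_initialSegment, if_pos hlt, Bool.and_eq_true,
    decide_eq_true_eq, List.nodup_ofFn, Option.some.injEq, charNat]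
  by_cases h : p.2 ∈ D <;> simp [h]

theorem reducible_satSet_fullExpansion (hM : IsBaseStructure LN N ℕ) (D : Set ℕ) :
    SetTuringReducible D (satSet (fullExpansion hM D)) := by
  -- On the elements `0, 1`, the `i`-th binary symbol holds of exactly the two pairs of distinct
  -- elements; this is true precisely for `i ∈ D`.
  let d : ℕ → DiagramCode := fun i =>
    ([0, 1], [(0, i)], [((0, i), [0, 1]), ((0, i), [1, 0])])
  have hd : Computable fun i => Encodable.encode (d i) := by
    have h₁ : ∀ l : List ℕ, Primrec fun i : ℕ => (((0, i), l) : (ℕ × ℕ) × List ℕ) := fun l =>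
      Primrec.pair (Primrec.pair (Primrec.const 0) Primrec.id) (Primrec.const l)
    refine Primrec.to_comp (Primrec.encode.comp (Primrec.pair (Primrec.const [0, 1])
      (Primrec.pair ?_ ?_)))
    · exact Primrec.list_cons.comp (Primrec.pair (Primrec.const 0) Primrec.id)
        (Primrec.const ([] : List (ℕ × ℕ)))
    · exact Primrec.list_cons.comp (h₁ [0, 1]) (Primrec.list_cons.comp (h₁ [1, 0])
        (Primrec.const []))
  have key : ∀ i, Encodable.encode (d i) ∈ satSet (fullExpansion hM D) ↔ i ∈ D := by
    intro i
    rw [mem_satSet_iff, Denumerable.ofNat_encode]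
    constructor
    · intro h
      have := (h (0, i) (List.mem_singleton_self _) ![0, 1] (by simp [d, Fin.forall_fin_two])).2
        (by simp [d])
      exact ((pRel_fullExpansion hM).1 this).2.2
    · intro hi p hp b hb
      obtain rfl := List.mem_singleton.1 hp
      rw [pRel_fullExpansion]
      have h₀ := hb 0
      have h₁ := hb 1
      have hinj : Function.Injective b ↔ b 0 ≠ b 1 := by
        refine ⟨fun h h' => absurd (h h') (by simp), fun h j k hjk => ?_⟩
        revert hjk
        revert j k
        simp [Fin.forall_fin_two, h, h.symm]
      simp only [d, List.mem_cons, List.not_mem_nil, or_false] at h₀ h₁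
      rw [hinj]
      rcases h₀ with h₀ | h₀ <;> rcases h₁ with h₁ | h₁ <;>
        simp [d, List.ofFn_succ, h₀, h₁, hi]
  have h₁ : Nat.RecursiveIn {charFun (satSet (fullExpansion hM D))}
      fun i => Part.some (Encodable.encode (d i)) :=
    Nat.Partrec.recursiveIn (Partrec.nat_iff.1 hd)
  refine (RecursiveIn.iff_nat.2
    (Nat.RecursiveIn.comp (.oracle _ (Set.mem_singleton _)) h₁)).of_eq fun i => ?_
  refine (Part.bind_some _ _).trans (congrArg Part.some (?_ :
    charNat (satSet (fullExpansion hM D)) (Encodable.encode (d i)) = charNat D i))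
  unfold charNat
  by_cases hi : i ∈ D
  · rw [if_pos hi, if_pos ((key i).2 hi)]
  · rw [if_neg hi, if_neg (mt (key i).1 hi)]

theorem hasDegreeOf_fullExpansion (hM : IsBaseStructure LN N ℕ) (D : Set ℕ) :
    HasDegreeOf (MulAction.orbit (autGroup (langZero LN)) (fullExpansion hM D)) D := by
  refine ⟨⟨_, MulAction.mem_orbit_self _, satSet_fullExpansion_reducible hM D,
    reducible_satSet_fullExpansion hM D⟩, fun y hy => ?_⟩
  rw [(mem_orbit_fullExpansion hM).1 hy]
  exact reducible_satSet_fullExpansion hM D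

end Degrees

/-! ### Generic sequences -/

/-- For countably many sets that depend on initial segments, there is a sequence such that each
of the sets contains it or is excluded by an initial segment of it. -/
theorem exists_generic {ι : Type*} [Countable ι] [Nonempty ι] {α : ℕ → Type*}
    [∀ n, Nonempty (α n)] (O : ι → Set (∀ n, α n))
    (hO : ∀ k, ∀ z ∈ O k, ∃ m, ∀ z' : ∀ n, α n, (∀ n < m, z' n = z n) → z' ∈ O k) :
    ∃ z : ∀ n, α n, ∀ k, z ∈ O k ∨
      ∃ m, ∀ z' : ∀ n, α n, (∀ n < m, z' n = z n) → z' ∉ O k := by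
  obtain ⟨e, he⟩ := exists_surjective_nat ι
  -- A pair `(z, m)` stands for the condition "agree with `z` below `m`". If some extension of the
  -- condition meets the open set, enter it; otherwise the condition already excludes it. The length
  -- always grows, so that the limit is total.
  have step : ∀ (k : ℕ) (s : (∀ n, α n) × ℕ), ∃ s' : (∀ n, α n) × ℕ, s.2 < s'.2 ∧
      (∀ n < s.2, s'.1 n = s.1 n) ∧
      ((∀ z', (∀ n < s'.2, z' n = s'.1 n) → z' ∈ O (e k)) ∨
        ∀ z', (∀ n < s'.2, z' n = s'.1 n) → z' ∉ O (e k)) := by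
    rintro k ⟨z, m⟩
    by_cases h : ∃ z' ∈ O (e k), ∀ n < m, z' n = z n
    · obtain ⟨z', hz', h⟩ := h
      obtain ⟨m', hm'⟩ := hO _ z' hz'
      exact ⟨(z', max (m + 1) m'), lt_of_lt_of_le (Nat.lt_succ_self m) (le_max_left _ _), h,
        Or.inl fun z'' h' => hm' z'' fun n hn => h' n (lt_of_lt_of_le hn (le_max_right _ _))⟩
    · push Not at h
      refine ⟨(z, m + 1), Nat.lt_succ_self m, fun _ _ => rfl, Or.inr fun z' h' hz' => ?_⟩
      obtain ⟨n, hn, hne⟩ := h z' hz'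
      exact hne (h' n (Nat.lt_succ_of_lt hn))
  choose next h₁ h₂ h₃ using step
  let S : ℕ → (∀ n, α n) × ℕ :=
    fun k => Nat.rec (fun n => Classical.arbitrary (α n), 0) (fun k s => next k s) k
  have hS : ∀ k, S (k + 1) = next k (S k) := fun k => rfl
  have mono : StrictMono fun k => (S k).2 := strictMono_nat_of_lt_succ fun k => by
    rw [hS]
    exact h₁ k (S k)
  have agree : ∀ k j, k ≤ j → ∀ n < (S k).2, (S j).1 n = (S k).1 n := by
    intro k j hkj
    induction j, hkj using Nat.le_induction with
    | base => exact fun _ _ => rfl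
    | succ j hkj ih =>
      intro n hn
      rw [hS, h₂ j (S j) n (lt_of_lt_of_le hn (mono.monotone hkj)), ih n hn]
  have lim : ∀ k, ∀ n < (S k).2, (S (n + 1)).1 n = (S k).1 n := by
    intro k n hn
    rcases le_total k (n + 1) with h | h
    · exact agree k (n + 1) h n hn
    · exact (agree (n + 1) k h n (lt_of_lt_of_le (Nat.lt_succ_self n) mono.le_apply)).symm
  refine ⟨fun n => (S (n + 1)).1 n, fun i => ?_⟩
  obtain ⟨k, rfl⟩ := he i
  have h₄ := h₃ k (S k)
  rw [← hS] at h₄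
  rcases h₄ with h | h
  · exact Or.inl (h _ (lim (k + 1)))
  · exact Or.inr ⟨(S (k + 1)).2, fun z' h' => h z' fun n hn => (h' n hn).trans (lim (k + 1) n hn)⟩

/-- The truth values of atomic facts in the expansion by the classes of finitely many tuples,
where `e` decides equivalence of tuples. -/
def classFacts (e : List ℕ → List ℕ → Bool) (w : List (List ℕ)) (r : (ℕ × ℕ) × List ℕ) : Bool :=
  (decide (r.1.2 = 0) && decide r.2.Nodup) &&
    ((decide ((w.getD r.1.1 []).length = r.1.1 + 2) && decide (w.getD r.1.1 []).Nodup) &&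
      e (w.getD r.1.1 []) r.2)

theorem computable₂_classFacts {e : List ℕ → List ℕ → Bool} (he : Computable₂ e) :
    Computable₂ (classFacts e) := by
  have hw : Primrec fun q : List (List ℕ) × (ℕ × ℕ) × List ℕ => q.1.getD q.2.1.1 [] :=
    (Primrec.list_getD []).comp Primrec.fst (Primrec.fst.comp (Primrec.fst.comp Primrec.snd))
  have h₁ : Primrec fun q : List (List ℕ) × (ℕ × ℕ) × List ℕ => decide (q.2.1.2 = 0) :=
    Primrec.eq.decide.comp (Primrec.snd.comp (Primrec.fst.comp Primrec.snd)) (Primrec.const 0)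
  have h₂ : Primrec fun q : List (List ℕ) × (ℕ × ℕ) × List ℕ => decide q.2.2.Nodup :=
    primrec_list_nodup.comp (Primrec.snd.comp Primrec.snd)
  have h₃ : Primrec fun q : List (List ℕ) × (ℕ × ℕ) × List ℕ =>
      decide ((q.1.getD q.2.1.1 []).length = q.2.1.1 + 2) :=
    Primrec.eq.decide.comp (Primrec.list_length.comp hw)
      (Primrec.nat_add.comp (Primrec.fst.comp (Primrec.fst.comp Primrec.snd)) (Primrec.const 2))
  have h₄ : Primrec fun q : List (List ℕ) × (ℕ × ℕ) × List ℕ =>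
      decide (q.1.getD q.2.1.1 []).Nodup := primrec_list_nodup.comp hw
  exact Primrec.and.to_comp.comp (Primrec.and.comp h₁ h₂).to_comp
    (Primrec.and.to_comp.comp (Primrec.and.comp h₃ h₄).to_comp
      (he.comp hw.to_comp (Computable.snd.comp Computable.snd)))

/-- The partial results of a computation that are obtained by a search through a computable
sequence of finite oracles. -/
theorem computable₂_evaln_unpair (e : Nat.Partrec.Code) {G : ℕ → List ℕ} (hG : Computable G) :
    Computable₂ fun k s : ℕ => Nat.Partrec.Code.evaln s.unpair.1 e
      (Nat.pair (Encodable.encode (G s.unpair.2)) k) := by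
  have h₁ : Computable fun q : ℕ × ℕ => Encodable.encode (G q.2.unpair.2) :=
    Computable.encode.comp (hG.comp (Computable.snd.comp (Computable.unpair.comp Computable.snd)))
  have h₂ : Computable fun q : ℕ × ℕ => (((q.2.unpair.1, e),
      Nat.pair (Encodable.encode (G q.2.unpair.2)) q.1) : (ℕ × Nat.Partrec.Code) × ℕ) :=
    Computable.pair (Computable.pair (Computable.fst.comp (Computable.unpair.comp Computable.snd))
      (Computable.const e)) (Primrec₂.natPair.to_comp.comp h₁ Computable.fst)
  exact Nat.Partrec.Code.primrec_evaln.to_comp.comp h₂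

section Degrees

variable {LN : FirstOrder.Language.{0, 0}} {N : Type} [LN.Structure N] [langE.Structure ℕ]
  [LN.Structure ℕ]

/-- Initial segments of the degree of an expansion by classes depend on finitely many classes. -/
theorem exists_initialSegment_charNat_congr (hM : IsBaseStructure LN N ℕ) (m : ℕ) :
    ∃ (k : ℕ) (T : ∀ n, Set (ESort (n + 1) ℕ)), (∀ n, (T n).Finite) ∧
      ∀ c c' : ∀ n, Option (ESort (n + 1) ℕ),
        (∀ n < k, ∀ s ∈ T n, c n = some s ↔ c' n = some s) →
        initialSegment (charNat (satSet (classExpansion hM c))) m =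
          initialSegment (charNat (satSet (classExpansion hM c'))) m := by
  let D : ℕ → DiagramCode := Denumerable.ofNat DiagramCode
  -- The first `m` diagrams mention finitely many elements and symbols, so they ask only whether the
  -- chosen classes are among those of tuples from `A`.
  let A : Set ℕ := ⋃ j : Fin m, {p | p ∈ (D j).1}
  have hA : A.Finite := Set.finite_iUnion fun j => List.finite_toSet _
  let I : Set ℕ := ⋃ j : Fin m, Prod.fst '' {p | p ∈ (D j).2.1}
  have hI : I.Finite := Set.finite_iUnion fun j => (List.finite_toSet _).image _
  obtain ⟨k, hk⟩ := hI.bddAbove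
  refine ⟨k + 1, fun n => {s | ∃ a : Fin (n + 2) → ℕ, (∀ i, a i ∈ A) ∧
    ∃ h : Function.Injective a, eProj a h = s}, fun n => ?_, fun c c' hc => ?_⟩
  · have h₁ : {a : Fin (n + 2) → ℕ | ∀ i, a i ∈ A}.Finite := by
      simpa [Set.pi] using Set.Finite.pi' (fun _ : Fin (n + 2) => hA)
    have : {s | ∃ a : Fin (n + 2) → ℕ, (∀ i, a i ∈ A) ∧
        ∃ h : Function.Injective a, eProj a h = s} ⊆
        some ⁻¹' ((fun a : Fin (n + 2) → ℕ =>
          if h : Function.Injective a then some (eProj a h) else none) '' {a | ∀ i, a i ∈ A}) := by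
      rintro s ⟨a, ha, h, rfl⟩
      exact ⟨a, ha, dif_pos h⟩
    exact ((h₁.image _).preimage (Option.some_injective _).injOn).subset this
  · refine initialSegment_congr fun j hj => ?_
    have hD : classExpansion hM c ∈ basicSet (D j) ↔ classExpansion hM c' ∈ basicSet (D j) := by
      refine mem_basicSet_congr fun p hp b hb => ?_
      rw [pRel_classExpansion, pRel_classExpansion]
      refine exists_congr fun h => and_congr_right fun _ => ?_
      exact hc p.1 (Nat.lt_succ_of_le (hk (Set.mem_iUnion.2 ⟨⟨j, hj⟩, p, hp, rfl⟩))) _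
        ⟨b, fun i => Set.mem_iUnion.2 ⟨⟨j, hj⟩, hb i⟩, h, rfl⟩
    have hm := (mem_satSet_iff _ j).trans (hD.trans (mem_satSet_iff _ j).symm)
    unfold charNat
    by_cases h : j ∈ satSet (classExpansion hM c)
    · rw [if_pos h, if_pos (hm.1 h)]
    · rw [if_neg h, if_neg (mt hm.2 h)]

/-! #### Expansions by finitely many classes -/

open Classical in
/-- The class of the tuple `l`, if it is an `(n + 2)`-tuple without repetitions. -/
noncomputable def classOfList (n : ℕ) (l : List ℕ) : Option (ESort (n + 1) ℕ) :=
  if h : ∃ a : Fin (n + 2) → ℕ, Function.Injective a ∧ List.ofFn a = l then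
    some (eProj h.choose h.choose_spec.1) else none

theorem classOfList_ofFn {n : ℕ} (a : Fin (n + 2) → ℕ) (h : Function.Injective a) :
    classOfList n (List.ofFn a) = some (eProj a h) := by
  have h' : ∃ b : Fin (n + 2) → ℕ, Function.Injective b ∧ List.ofFn b = List.ofFn a := ⟨a, h, rfl⟩
  rw [classOfList, dif_pos h']
  exact congrArg some (eProj_congr (List.ofFn_injective h'.choose_spec.2) _ _)

theorem exists_classOfList_eq (n : ℕ) (o : Option (ESort (n + 1) ℕ)) :
    ∃ l, classOfList n l = o := by
  cases o with
  | none =>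
    refine ⟨[], dif_neg ?_⟩
    rintro ⟨a, -, ha⟩
    simpa using congrArg List.length ha
  | some s =>
    obtain ⟨a, h, rfl⟩ := exists_eProj_eq s
    exact ⟨_, classOfList_ofFn a h⟩

/-- The sequence of classes of a finite sequence of tuples. -/
noncomputable def classesOfLists (w : List (List ℕ)) (n : ℕ) : Option (ESort (n + 1) ℕ) :=
  classOfList n (w.getD n [])

/-- A list of the wrong length or with a repetition, in particular the default `[]`, denotes no
class; the guards in `classFacts` make the symbol empty in this case. -/
theorem classFacts_iff (hM : IsBaseStructure LN N ℕ) {e : List ℕ → List ℕ → Bool}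
    (he : ∀ n (a b : Fin (n + 1) → ℕ), e (List.ofFn a) (List.ofFn b) = true ↔ eRel a b)
    (w : List (List ℕ)) (p : ℕ × ℕ) (b : Fin (p.1 + 2) → ℕ) :
    classFacts e w (p, List.ofFn b) = true ↔
      pRel (classExpansion hM (classesOfLists w)).1 p.1 p.2 b := by
  have hE := isEStructure_of_isFraisseLimit hM.1
  rw [pRel_classExpansion]
  simp only [classFacts, Bool.and_eq_true, decide_eq_true_eq, List.nodup_ofFn, classesOfLists]
  generalize w.getD p.1 [] = l
  constructor
  · rintro ⟨⟨h₁, h₂⟩, ⟨h₃, h₄⟩, h₅⟩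
    obtain ⟨a, rfl⟩ := exists_ofFn_eq h₃
    rw [List.nodup_ofFn] at h₄
    refine ⟨h₂, h₁, ?_⟩
    rw [classOfList_ofFn a h₄, Option.some.injEq, hE.eProj_eq_iff]
    exact (he _ a b).1 h₅
  · rintro ⟨h₂, h₁, h₃⟩
    by_cases h : ∃ a : Fin (p.1 + 2) → ℕ, Function.Injective a ∧ List.ofFn a = l
    · obtain ⟨a, ha, rfl⟩ := h
      rw [classOfList_ofFn a ha, Option.some.injEq, hE.eProj_eq_iff] at h₃
      exact ⟨⟨h₁, h₂⟩, ⟨List.length_ofFn, List.nodup_ofFn.2 ha⟩, (he _ a b).2 h₃⟩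
    · rw [classOfList, dif_neg h] at h₃
      simp at h₃

/-! #### An orbit without a degree -/

/-- The value that a computation gives on input `k` with an initial segment of length `m` of the
degree of the expansion by the classes `c`. -/
noncomputable def evalSegment (hM : IsBaseStructure LN N ℕ) (e : Nat.Partrec.Code)
    (c : ∀ n, Option (ESort (n + 1) ℕ)) (m k : ℕ) : Part ℕ :=
  e.eval (Nat.pair (Encodable.encode
    (initialSegment (charNat (satSet (classExpansion hM c))) m)) k)

/-- By the use principle the reduction becomes a single partial recursive function of an initial
segment and the input. Such functions have codes, so the possible reductions are countably many. -/
theorem exists_evalSegment (hM : IsBaseStructure LN N ℕ) {c : ∀ n, Option (ESort (n + 1) ℕ)}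
    {D : Set ℕ} (h : SetTuringReducible D (satSet (classExpansion hM c))) :
    ∃ e : Nat.Partrec.Code, ∀ k v, v = charNat D k ↔ ∃ m, v ∈ evalSegment hM e c m k := by
  obtain ⟨F, hF, hF'⟩ := exists_initialSegment_of_recursiveIn (RecursiveIn.iff_nat.1 h)
  have : Partrec fun q : ℕ => F (Denumerable.ofNat (List ℕ) q.unpair.1) q.unpair.2 :=
    hF.comp ((Computable.ofNat (List ℕ)).comp (Computable.fst.comp Computable.unpair))
      (Computable.snd.comp Computable.unpair)
  obtain ⟨e, he⟩ := Nat.Partrec.Code.exists_code.1 (Partrec.nat_iff.1 this)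
  refine ⟨e, fun k v => ?_⟩
  have := (hF' k).mem_iff v
  rw [charFun_eq, Part.mem_some_iff] at this
  rw [this]
  simp only [evalSegment, he, Nat.unpair_pair, Denumerable.ofNat_encode]
  rfl

/-- If two computations with the expansions by `c` and `c'` give the same total function, and
disagreement is excluded by initial segments of `c` and `c'`, then this function is computable. -/
theorem partrec_charFun_of_not_disagree (hM : IsBaseStructure LN N ℕ)
    {e : List ℕ → List ℕ → Bool} (he : Computable₂ e)
    (he' : ∀ n (a b : Fin (n + 1) → ℕ), e (List.ofFn a) (List.ofFn b) = true ↔ eRel a b)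
    {c c' : ∀ n, Option (ESort (n + 1) ℕ)} {D : Set ℕ} {e₁ e₂ : Nat.Partrec.Code}
    (h₁ : ∀ k v, v = charNat D k ↔ ∃ m, v ∈ evalSegment hM e₁ c m k)
    (h₂ : ∀ k v, v = charNat D k ↔ ∃ m, v ∈ evalSegment hM e₂ c' m k) {l : ℕ}
    (hl : ∀ d d' : ∀ n, Option (ESort (n + 1) ℕ), (∀ n, (d n).isSome = (d' n).isSome) →
      (∀ n < l, d n = c n ∧ d' n = c' n) → ∀ k m m', ∀ v ∈ evalSegment hM e₁ d m k,
        ∀ v' ∈ evalSegment hM e₂ d' m' k, v = v')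
    (hcc' : ∀ n, (c n).isSome = (c' n).isSome) :
    Partrec (charFun D) := by
  classical
  choose r hr using fun n => exists_classOfList_eq n (c n)
  let w₀ : List (List ℕ) := initialSegment r l
  let D' : ℕ → List (List ℕ) × ℕ := Denumerable.ofNat (List (List ℕ) × ℕ)
  -- The number `j` codes a finite continuation of `w₀` and a length; `G j` is the resulting finite
  -- oracle, which is computable because `e` decides equivalence.
  let G : ℕ → List ℕ := fun j => initialSegment (satFun (classFacts e (w₀ ++ (D' j).1))) (D' j).2
  have hG : Computable G := by
    have hD' : Computable D' := Computable.ofNat _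
    have hw : Computable fun j => w₀ ++ (D' j).1 :=
      Computable.list_append.comp (Computable.const w₀) (Computable.fst.comp hD')
    exact Computable.initialSegment (Computable.snd.comp hD')
      ((computable₂_satFun (computable₂_classFacts he)).comp (hw.comp Computable.fst)
        Computable.snd)
  let f : ℕ → ℕ → Option ℕ := fun k s => Nat.Partrec.Code.evaln s.unpair.1 e₁
    (Nat.pair (Encodable.encode (G s.unpair.2)) k)
  have hf : Computable₂ f := computable₂_evaln_unpair e₁ hG
  have hsat : ∀ w m, initialSegment (satFun (classFacts e w)) m =
      initialSegment (charNat (satSet (classExpansion hM (classesOfLists w)))) m := fun w m =>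
    initialSegment_congr fun i _ => (charNat_satSet fun p _ b => classFacts_iff hM he' w p b).symm
  have hw₀ : ∀ w, ∀ n < l, classesOfLists (w₀ ++ w) n = c n := fun w n hn => by
    have : (w₀ ++ w).getD n [] = r n := by
      rw [List.getD_eq_getElem?_getD, List.getElem?_append_left (by simpa [w₀, initialSegment]),
        getElem?_initialSegment, if_pos hn, Option.getD_some]
    rw [classesOfLists, this, hr]
  -- The value found is compared with the true value obtained from `c'`. Since the domains of `d`
  -- and `c'` may differ, both are enlarged to their union by classes outside the finite sets that
  -- the two computations inspect.
  have sound : ∀ k s v, v ∈ f k s → v = charNat D k := by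
    intro k s v hv
    have hv := Nat.Partrec.Code.evaln_sound hv
    simp only [G, hsat] at hv
    generalize D' s.unpair.2 = t at hv
    have hv : v ∈ evalSegment hM e₁ (classesOfLists (w₀ ++ t.1)) t.2 k := hv
    obtain ⟨m', hm'⟩ := (h₂ k _).1 rfl
    have hd := hw₀ t.1
    generalize classesOfLists (w₀ ++ t.1) = d at hv hd
    generalize t.2 = m at hv
    obtain ⟨_, T, hT, hTm⟩ := exists_initialSegment_charNat_congr hM m
    obtain ⟨_, T', hT', hTm'⟩ := exists_initialSegment_charNat_congr hM m'
    have fresh : ∀ (T : ∀ n, Set (ESort (n + 1) ℕ)), (∀ n, (T n).Finite) → ∀ n, ∃ s, s ∉ T n :=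
      fun T hT n => by
        have := infinite_eSort hM.1 (n + 1)
        exact (hT n).exists_notMem
    choose u hu using fresh T hT
    choose u' hu' using fresh T' hT'
    let d₁ : ∀ n, Option (ESort (n + 1) ℕ) := fun n =>
      if (d n).isNone ∧ (c' n).isSome then some (u n) else d n
    let d₂ : ∀ n, Option (ESort (n + 1) ℕ) := fun n =>
      if (c' n).isNone ∧ (d n).isSome then some (u' n) else c' n
    have e₁' : ∀ n, ∀ s ∈ T n, d₁ n = some s ↔ d n = some s := fun n s hs => by
      simp only [d₁]
      split_ifs with h
      · have h' : u n ≠ s := fun h => hu n (h ▸ hs)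
        simp [h', Option.isNone_iff_eq_none.1 h.1]
      · rfl
    have e₂' : ∀ n, ∀ s ∈ T' n, d₂ n = some s ↔ c' n = some s := fun n s hs => by
      simp only [d₂]
      split_ifs with h
      · have h' : u' n ≠ s := fun h => hu' n (h ▸ hs)
        simp [h', Option.isNone_iff_eq_none.1 h.1]
      · rfl
    refine hl d₁ d₂ (fun n => ?_) (fun n hn => ?_) k m m' v ?_ _ ?_
    · simp only [d₁, d₂]
      cases h : d n <;> cases h' : c' n <;> simp
    -- Below `l` the domains of `d` and `c'` agree, because there `d` is `c`; hence nothing is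
    -- added.
    · have h₄ := hcc' n
      rw [← hd n hn] at h₄ ⊢
      simp only [d₁, d₂]
      cases h : d n <;> cases h' : c' n <;> first | (simp; done) | simp [h, h'] at h₄
    · unfold evalSegment
      rwa [hTm d₁ d fun n _ => e₁' n]
    · unfold evalSegment
      rwa [hTm' d₂ c' fun n _ => e₂' n]
  -- The search succeeds on a sufficiently long part of `c` itself, by the finite use of the
  -- computation from `c`.
  have complete : ∀ k, ∃ s v, v ∈ f k s := by
    intro k
    obtain ⟨m, hm⟩ := (h₁ k _).1 rfl
    obtain ⟨K, T, -, hT⟩ := exists_initialSegment_charNat_congr hM m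
    let w := initialSegment (fun j => r (l + j)) K
    have hw : ∀ n < K, classesOfLists (w₀ ++ w) n = c n := fun n hn => by
      rcases lt_or_ge n l with h | h
      · exact hw₀ w n h
      · have : (w₀ ++ w).getD n [] = r n := by
          have hlen : w₀.length = l := by simp [w₀, initialSegment]
          rw [List.getD_eq_getElem?_getD, List.getElem?_append_right (by rwa [hlen]), hlen,
            getElem?_initialSegment, if_pos (by omega), Option.getD_some, Nat.add_sub_cancel' h]
        rw [classesOfLists, this, hr]
    unfold evalSegment at hm
    rw [← hT (classesOfLists (w₀ ++ w)) c fun n hn s _ => by rw [hw n hn], ← hsat] at hm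
    obtain ⟨fuel, hfuel⟩ := Nat.Partrec.Code.evaln_complete.1 hm
    refine ⟨Nat.pair fuel (Encodable.encode (w, m)), charNat D k, ?_⟩
    simp only [f, G, D', Nat.unpair_pair, Denumerable.ofNat_encode]
    exact hfuel
  refine (Partrec.rfindOpt hf).of_eq fun k => ?_
  obtain ⟨s, v, hv⟩ := complete k
  obtain ⟨v', hv'⟩ := Part.dom_iff_mem.1 (Nat.rfindOpt_dom.2 ⟨s, v, hv⟩)
  obtain ⟨s', hs'⟩ := Nat.rfindOpt_spec hv'
  obtain rfl := sound k s' v' hs'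
  exact Part.eq_some_iff.2 hv'

/-- An expansion is determined by its set of diagrams, and there are only countably many partial
recursive functions. -/
theorem countable_setOf_partrec_charFun_satSet :
    Countable {y : Expansions LN N // Partrec (charFun (satSet y))} := by
  have inj : Function.Injective charFun := fun A B h => by
    ext m
    have := Part.some_injective (congrFun h m)
    by_cases hA : m ∈ A <;> by_cases hB : m ∈ B <;> simp_all
  have : Function.Injective fun y : {y : Expansions LN N // Partrec (charFun (satSet y))} =>
      (⟨charFun (satSet y.1), y.2⟩ : {f : ℕ →. ℕ // Partrec f}) := fun y y' h =>
    Subtype.ext (satSet_injective (inj (congrArg Subtype.val h)))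
  exact this.countable

/-- The generic object `z` chooses pairs of classes, so its two coordinates have a common domain and
give two members of one orbit. A least degree lies below both, hence is computable, while no member
of the orbit is. -/
theorem exists_classExpansion_not_hasDegreeOf (hM : IsBaseStructure LN N ℕ) [LN.IsRelational]
    {e : List ℕ → List ℕ → Bool} (he : Computable₂ e)
    (he' : ∀ n (a b : Fin (n + 1) → ℕ), e (List.ofFn a) (List.ofFn b) = true ↔ eRel a b) :
    ∃ c : ∀ n, Option (ESort (n + 1) ℕ), ¬ ∃ D : Set ℕ,
      HasDegreeOf (MulAction.orbit (autGroup (langZero LN)) (classExpansion hM c)) D := by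
  classical
  let Y := {y : Expansions LN N // Partrec (charFun (satSet y))}
  have : Countable Y := countable_setOf_partrec_charFun_satSet
  let c₁ : (∀ n, Option (ESort (n + 1) ℕ × ESort (n + 1) ℕ)) → ∀ n, Option (ESort (n + 1) ℕ) :=
    fun z n => (z n).map Prod.fst
  let c₂ : (∀ n, Option (ESort (n + 1) ℕ × ESort (n + 1) ℕ)) → ∀ n, Option (ESort (n + 1) ℕ) :=
    fun z n => (z n).map Prod.snd
  -- Two kinds of open sets: two computations from the coordinates disagree at some input, or the
  -- domain of `z` differs from that of a computable expansion `y`.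
  let O : (Nat.Partrec.Code × Nat.Partrec.Code) ⊕ Y →
      Set (∀ n, Option (ESort (n + 1) ℕ × ESort (n + 1) ℕ)) := Sum.elim
    (fun p => {z | ∃ k m m' v v', v ∈ evalSegment hM p.1 (c₁ z) m k ∧
      v' ∈ evalSegment hM p.2 (c₂ z) m' k ∧ v ≠ v'})
    (fun y => {z | ∃ n, ¬ ((z n).isSome ↔ ∃ a, pRel y.1.1 n 0 a)})
  obtain ⟨z, hz⟩ := exists_generic O (by
    rintro (⟨p, p'⟩ | y) z
    · rintro ⟨k, m, m', v, v', hv, hv', hne⟩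
      obtain ⟨K, T, -, hT⟩ := exists_initialSegment_charNat_congr hM m
      obtain ⟨K', T', -, hT'⟩ := exists_initialSegment_charNat_congr hM m'
      refine ⟨max K K', fun z' hz' => ⟨k, m, m', v, v', ?_, ?_, hne⟩⟩
      · unfold evalSegment
        rwa [hT (c₁ z') (c₁ z) fun n hn s _ => by
          simp only [c₁, hz' n (lt_of_lt_of_le hn (le_max_left _ _))] ]
      · unfold evalSegment
        rwa [hT' (c₂ z') (c₂ z) fun n hn s _ => by
          simp only [c₂, hz' n (lt_of_lt_of_le hn (le_max_right _ _))] ]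
    · rintro ⟨n, hn⟩
      refine ⟨n + 1, fun z' hz' => ⟨n, ?_⟩⟩
      rwa [hz' n (Nat.lt_succ_self n)])
  refine ⟨c₁ z, ?_⟩
  rintro ⟨D, ⟨y, hy, hyD, -⟩, hD⟩
  have hdom : ∀ n, (c₁ z n).isSome = (c₂ z n).isSome := fun n => by simp [c₁, c₂]
  obtain ⟨e₁, h₁⟩ := exists_evalSegment hM (hD _ (MulAction.mem_orbit_self _))
  obtain ⟨e₂, h₂⟩ := exists_evalSegment hM (hD _ (classExpansion_mem_orbit hM hdom))
  have hDc : Partrec (charFun D) := by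
    rcases hz (Sum.inl (e₁, e₂)) with ⟨k, m, m', v, v', hv, hv', hne⟩ | ⟨l, hl⟩
    · exact absurd (((h₁ k v).2 ⟨m, hv⟩).trans ((h₂ k v').2 ⟨m', hv'⟩).symm) hne
    · refine partrec_charFun_of_not_disagree hM he he' h₁ h₂ (l := l)
        (fun d d' hdd' hd k m m' v hv v' hv' => ?_) hdom
      by_contra hne
      -- Since `d` and `d'` have equal domains, they are the coordinates of one sequence that
      -- extends `z` below `l`.
      have hz' : ∀ n, ∃ o : Option (ESort (n + 1) ℕ × ESort (n + 1) ℕ),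
          (n < l → o = z n) ∧ o.map Prod.fst = d n ∧ o.map Prod.snd = d' n := fun n => by
        by_cases hn : n < l
        · exact ⟨z n, fun _ => rfl, (hd n hn).1.symm, (hd n hn).2.symm⟩
        · have := hdd' n
          cases h : d n with
          | none =>
            cases h' : d' n with
            | none => exact ⟨none, fun h => absurd h hn, rfl, rfl⟩
            | some s' => simp [h, h'] at this
          | some s =>
            cases h' : d' n with
            | none => simp [h, h'] at this
            | some s' => exact ⟨some (s, s'), fun h => absurd h hn, rfl, rfl⟩
      choose z' hz'₀ hz'₁ hz'₂ using hz'
      refine hl z' hz'₀ ⟨k, m, m', v, v', ?_, ?_, hne⟩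
      · rwa [show c₁ z' = d from funext hz'₁]
      · rwa [show c₂ z' = d' from funext hz'₂]
  have hyc : Partrec (charFun (satSet y)) := RecursiveIn.partrec_of_oracle (fun g hg => by
    rwa [Set.mem_singleton_iff.1 hg]) hyD
  have hydom : ∀ n, (z n).isSome ↔ ∃ a, pRel y.1 n 0 a := fun n => by
    rw [exists_pRel_iff_of_mem_orbit hy, exists_pRel_classExpansion_iff hM]
    simp [c₁]
  rcases hz (Sum.inr ⟨y, hyc⟩) with ⟨n, hn⟩ | ⟨l, hl⟩
  · exact hn (hydom n)
  · have := infinite_eSort hM.1 (l + 1)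
    let s : ESort (l + 1) ℕ := Classical.arbitrary _
    -- An initial segment cannot force the domain to equal that of `y`: changing at `l` whether a
    -- choice is made leaves the segment intact and makes the domains differ.
    let z' := Function.update z l (if (z l).isSome then none else some (s, s))
    refine hl z' (fun n hn => Function.update_of_ne hn.ne _ _) ⟨l, ?_⟩
    rw [← hydom l]
    by_cases h : (z l).isSome <;> simp [z', h]

end Degrees

theorem theorem4p4 (LN : FirstOrder.Language.{0, 0}) [LN.IsRelational] (c : ComputableLanguage LN)
    (N : Type) [LN.Structure N] [Countable N] [Infinite N]
    (hcat : Cardinal.Categorical (Cardinal.aleph0.{0}) (LN.completeTheory N))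
    (hmc : IsModelComplete (LN.completeTheory N))
    (hdec : HasDecidableTheory c.symCode N)
    [langE.Structure ℕ] [LN.Structure ℕ] (hM : IsBaseStructure LN N ℕ)
    (hMdec : HasDecidableElementaryDiagram (L := langZero LN) (symCodeZero c.symCode)) :
    (∀ D : Set ℕ, ∃ x : Expansions LN N,
      IsCanonicalPiece (autGroup (langZero LN)) basicSet
          (MulAction.orbit (autGroup (langZero LN)) x) ∧
        HasDegreeOf (MulAction.orbit (autGroup (langZero LN)) x) D) ∧
    ∃ x : Expansions LN N,
      IsCanonicalPiece (autGroup (langZero LN)) basicSet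
          (MulAction.orbit (autGroup (langZero LN)) x) ∧
        ¬ ∃ D : Set ℕ, HasDegreeOf (MulAction.orbit (autGroup (langZero LN)) x) D := by
  refine ⟨fun D => ⟨fullExpansion hM D, isCanonicalPiece_fullExpansion hM D,
    hasDegreeOf_fullExpansion hM D⟩, ?_⟩
  obtain ⟨e, he, he'⟩ := exists_computable_eRel c.symCode hMdec
  obtain ⟨c, hc⟩ := exists_classExpansion_not_hasDegreeOf hM he he'
  exact ⟨classExpansion hM c, isCanonicalPiece_classExpansion hM c, hc⟩
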